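/- Let $G=(V,E)$ be a finite undirected simple graph with vertex weights $w:V\to\mathbb{N}\cup\{\infty\}$. A vertex dominates itself and its neighbours; a set $D\subseteq V$ is an efficient dominating set (e.d.) of $G$ if every vertex of $G$ is dominated by exactly one vertex of $D$; the weight of $D$ is $w(D)=\sum_{v\in D}w(v)$. The Weighted Efficient Domination problem (WED) asks, given $(G,w)$, for an e.d. of $G$ of minimum weight among all e.d.s, this weight being finite, or for the decision that $G$ has no e.d. of finite weight. A graph is $P_6$-free if it has no induced subgraph isomorphic to the chordless path $P_6$ on six vertices. Theorem. WED is solvable in polynomial time for $P_6$-free graphs. That is, there are an algorithm (a program of a random access machine with addition and truncated subtraction, under the logarithmic cost measure) and a polynomial $p$ such that, for every $P_6$-free graph $G$ with $V = \{0,\dots,n-1\}$ (given by $n$ and its adjacency matrix) and every weight function $w:V\to\mathbb{N}\cup\{\infty\}$ (given in binary), the algorithm halts on input $(G,w)$ within time $p(L)$, where $L$ is the length of the input, and returns a correct answer: an e.d. of $G$ of minimum, finite weight, or the information that no e.d. of finite weight exists. -/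

import Mathlib

/-! # Random access machines with logarithmic cost -/

namespace RAM

/-- A state of the machine. The machine has memories `0, 1, 2, …`; each of them consists of cells
`0, 1, 2, …`, and each cell holds a natural number: `s m i` is the content of cell `i` of
memory `m`. (A program names only finitely many memories.) -/
abbrev State : Type := ℕ → ℕ → ℕ

/-- Arithmetic expressions. -/
inductive Expr : Type where
  /-- A numeral. -/
  | const (k : ℕ) : Expr
  /-- The content of the cell of memory `m` whose address is the value of `a`. -/
  | load (m : ℕ) (a : Expr) : Expr
  /-- Addition. -/
  | add (a b : Expr) : Expr
  /-- Truncated subtraction. -/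
  | sub (a b : Expr) : Expr

/-- The value of an expression in a state. -/
def Expr.eval (s : State) : Expr → ℕ
  | .const k => k
  | .load m a => s m (a.eval s)
  | .add a b => a.eval s + b.eval s
  | .sub a b => a.eval s - b.eval s

/-- The logarithmic cost of evaluating an expression: every operation costs `1` plus the number of
binary digits of its result. The digits of the operands, and of the addresses, are charged where
they are computed. -/
def Expr.cost (s : State) : Expr → ℕ
  | .const k => 1 + Nat.size k
  | .load m a => a.cost s + (1 + Nat.size (s m (a.eval s)))
  | .add a b => a.cost s + b.cost s + (1 + Nat.size (a.eval s + b.eval s))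
  | .sub a b => a.cost s + b.cost s + (1 + Nat.size (a.eval s - b.eval s))

/-- Programs of the machine. -/
inductive Prog : Type where
  /-- Do nothing. -/
  | skip : Prog
  /-- Write the value of `e` into the cell of memory `m` whose address is the value of `a`. -/
  | store (m : ℕ) (a e : Expr) : Prog
  /-- Run `P`, then `Q`. -/
  | seq (P Q : Prog) : Prog
  /-- Run `P` if the value of `c` is nonzero, and `Q` otherwise. -/
  | branch (c : Expr) (P Q : Prog) : Prog
  /-- While the value of `c` is nonzero, run `P`. -/
  | loop (c : Expr) (P : Prog) : Prog

/-- `Exec P s t s'`: started in state `s`, the program `P` halts after time `t` (in the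
logarithmic cost measure) in state `s'`. -/
inductive Exec : Prog → State → ℕ → State → Prop
  | skip (s : State) : Exec .skip s 1 s
  | store (m : ℕ) (a e : Expr) (s : State) :
      Exec (.store m a e) s (a.cost s + e.cost s + 1)
        (Function.update s m (Function.update (s m) (a.eval s) (e.eval s)))
  | seq {P Q : Prog} {s₁ s₂ s₃ : State} {t₁ t₂ : ℕ} :
      Exec P s₁ t₁ s₂ → Exec Q s₂ t₂ s₃ → Exec (.seq P Q) s₁ (t₁ + t₂) s₃
  | branch_true {c : Expr} {P Q : Prog} {s s' : State} {t : ℕ} :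
      c.eval s ≠ 0 → Exec P s t s' → Exec (.branch c P Q) s (c.cost s + 1 + t) s'
  | branch_false {c : Expr} {P Q : Prog} {s s' : State} {t : ℕ} :
      c.eval s = 0 → Exec Q s t s' → Exec (.branch c P Q) s (c.cost s + 1 + t) s'
  | loop_done {c : Expr} {P : Prog} {s : State} :
      c.eval s = 0 → Exec (.loop c P) s (c.cost s + 1) s
  | loop_step {c : Expr} {P : Prog} {s₁ s₂ s₃ : State} {t₁ t₂ : ℕ} :
      c.eval s₁ ≠ 0 → Exec P s₁ t₁ s₂ → Exec (.loop c P) s₂ t₂ s₃ →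
        Exec (.loop c P) s₁ (c.cost s₁ + 1 + t₁ + t₂) s₃

/-- The machine is deterministic: running time and final state are unique. -/
theorem Exec.deterministic {P : Prog} {s s' s'' : State} {t t' : ℕ}
    (h : Exec P s t s') (h' : Exec P s t' s'') : t = t' ∧ s' = s'' := by
  induction h generalizing t' s'' with
  | skip s => cases h'; exact ⟨rfl, rfl⟩
  | store m a e s => cases h'; exact ⟨rfl, rfl⟩
  | seq _ _ ih₁ ih₂ =>
    cases h' with
    | seq k₁ k₂ =>
      obtain ⟨rfl, rfl⟩ := ih₁ k₁
      obtain ⟨rfl, rfl⟩ := ih₂ k₂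
      exact ⟨rfl, rfl⟩
  | branch_true hc _ ih =>
    cases h' with
    | branch_true _ k => obtain ⟨rfl, rfl⟩ := ih k; exact ⟨rfl, rfl⟩
    | branch_false kc _ => exact absurd kc hc
  | branch_false hc _ ih =>
    cases h' with
    | branch_true kc _ => exact absurd hc kc
    | branch_false _ k => obtain ⟨rfl, rfl⟩ := ih k; exact ⟨rfl, rfl⟩
  | loop_done hc =>
    cases h' with
    | loop_done _ => exact ⟨rfl, rfl⟩
    | loop_step kc _ _ => exact absurd hc kc
  | loop_step hc _ _ ih₁ ih₂ =>
    cases h' with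
    | loop_done kc => exact absurd kc hc
    | loop_step _ k₁ k₂ =>
      obtain ⟨rfl, rfl⟩ := ih₁ k₁
      obtain ⟨rfl, rfl⟩ := ih₂ k₂
      exact ⟨rfl, rfl⟩

/-- The content of a memory that holds the list `l` in its first cells and `0` elsewhere. -/
def memOf (l : List ℕ) : ℕ → ℕ := fun i => l.getD i 0

/-- The initial state on the input `[l₁, …, l_k]`: memory `j` holds the list `l_j` for
`1 ≤ j ≤ k`; memory `0`, which will receive the output, and all other memories are zero. -/
def initial (x : List (List ℕ)) : State
  | 0 => memOf []
  | j + 1 => memOf (x.getD j [])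

/-- The length of an input: the total number of binary digits of its numbers, plus one separator
for each number. -/
def inputLength (x : List (List ℕ)) : ℕ :=
  (x.map fun l => (l.map fun a => Nat.size a + 1).sum).sum

/-- Polynomial-time solvability of a search problem on a class `K` of instances.
`Inst` is the type of instances, `Ans x` the type of possible answers for the instance `x`, and
`Correct x y` says that `y` is a correct answer for `x`. Solvable in polynomial time on `K`: there
are one program and one polynomial such that on every instance in `K` the program halts, within a
time bounded by the polynomial in the length of the encoded instance, with the encoding of a correct
answer in memory `0`. -/
def SolvableInPolyTime {Inst : Type} {Ans : Inst → Type}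
    (encode : Inst → List (List ℕ)) (encodeAns : (x : Inst) → Ans x → List ℕ)
    (Correct : (x : Inst) → Ans x → Prop) (K : Set Inst) : Prop :=
  ∃ (P : Prog) (p : Polynomial ℕ), ∀ x ∈ K, ∃ (t : ℕ) (s : State) (y : Ans x),
    Exec P (initial (encode x)) t s ∧ t ≤ p.eval (inputLength (encode x)) ∧
      s 0 = memOf (encodeAns x y) ∧ Correct x y

end RAM

/-! # Weighted efficient domination -/

namespace SimpleGraph

/-- `D` is an efficient dominating set of `G`: every vertex is dominated by exactly one vertex
of `D`, where a vertex dominates itself and its neighbours. -/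
def IsEfficientDominatingSet {V : Type*} (G : SimpleGraph V) (D : Set V) : Prop :=
  ∀ v, ∃! d, d ∈ D ∧ (d = v ∨ G.Adj d v)

/-- `G` is `F`-free: no induced subgraph of `G` is isomorphic to `F`. -/
def IsInducedFree {V W : Type*} (F : SimpleGraph W) (G : SimpleGraph V) : Prop :=
  ¬ F.IsIndContained G

end SimpleGraph

namespace WED

/-- An instance of the problem: a finite simple graph with vertices `0, …, n - 1` and a weight in
`ℕ ∪ {∞}` for every vertex. -/
structure Instance : Type where
  n : ℕ
  graph : SimpleGraph (Fin n)
  weight : Fin n → ℕ∞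

/-- An answer: a vertex set, or the claim that there is no solution. -/
abbrev Answer (x : Instance) : Type := Option (Finset (Fin x.n))

/-- The weight of a vertex set. -/
def Instance.weightOf (x : Instance) (D : Finset (Fin x.n)) : ℕ∞ := ∑ v ∈ D, x.weight v

/-- The correct answers: an efficient dominating set whose weight is finite and minimum, or
`none` if there is no efficient dominating set of finite weight. -/
def IsCorrect (x : Instance) : Answer x → Prop
  | some D => x.graph.IsEfficientDominatingSet (D : Set (Fin x.n)) ∧ x.weightOf D ≠ ⊤ ∧
      ∀ D' : Finset (Fin x.n), x.graph.IsEfficientDominatingSet (D' : Set (Fin x.n)) →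
        x.weightOf D ≤ x.weightOf D'
  | none => ∀ D' : Finset (Fin x.n), x.graph.IsEfficientDominatingSet (D' : Set (Fin x.n)) →
      x.weightOf D' = ⊤

/-- A weight as a natural number: `∞` becomes `0`, and a finite `k` becomes `k + 1`. -/
def encodeWeight (a : ℕ∞) : ℕ := ENat.recTopCoe 0 (fun k => k + 1) a

open Classical in
/-- The encoding of an instance: the number of vertices, the `n × n` adjacency matrix row by row
(the entry for `u, v` at position `u * n + v`), and the weights. -/
noncomputable def encode (x : Instance) : List (List ℕ) :=
  [[x.n],
    List.ofFn fun i : Fin (x.n * x.n) => if x.graph.Adj i.divNat i.modNat then 1 else 0,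
    List.ofFn fun v : Fin x.n => encodeWeight (x.weight v)]

/-- The encoding of an answer: `0` for `none`, and `1` followed by the characteristic vector for a
vertex set. -/
def encodeAnswer (x : Instance) : Answer x → List ℕ
  | none => [0]
  | some D => 1 :: List.ofFn fun v : Fin x.n => if v ∈ D then 1 else 0

end WED

/-! In a `P_6`-free graph any two vertices of a component have distance at most four
(`Near4.trans`), so components are handled separately. Fix a component and an e.d. `D`. The
algorithm guesses three vertices `v`, `d`, `e` of `D` there, not necessarily distinct, such that the
rest of `D` in the component splits into independent choices.

Call a vertex of the component free (`Avail`) if its distance from `v`, `d` and `e` exceeds two.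
Shadowing is close enough to a total preorder on `D` that some `d` shadows all of `D` in the
component (`exists_forall_shadows`). The sets of links touched by the vertices at distance two from
`v` form a chain, so some `e` dominates a vertex touching every link (`exists_forall_link_touches`).
This yields two facts (`exists_isGuide`). Adjacent free vertices have the same dominator in `D`;
hence the free vertices fall into classes, one for each remaining vertex of `D`, and these classes
can be recognised without knowing `D` (`IsGuide.mate_iff`). And if `y` is not dominated by the
guess, then either every vertex of its dominator's class dominates `y`, or all free vertices
dominating `y` lie in that class.

Therefore each free vertex can be tested on its own for whether it may represent its class (`Good`).
The vertices of `D` pass the test, and one good vertex per class completes the guess; the lightest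
ones weigh no more than `D` (`IsGuide.valid`, `IsGuide.cost_le`). `Valid` checks the outcome
directly, so wrong guesses do no harm, and the cheapest valid guess in each component gives an
optimal e.d.

All of this is a fixed formula with quantifiers over vertices and sums of weights. Such a formula
becomes a term with nested sums of fixed depth, which the machine evaluates in polynomial time
(`Term.exists_exec_prog`). -/

namespace RAM

/-! ### Terms with bounded sums and their evaluation in polynomial time -/

/-- Terms over the input with `d` free variables: constants, variables, the content of a cell of the
first three input memories, addition, truncated subtraction, and sums whose index runs over the
numbers below the content of the first cell of memory `1`. -/
inductive Term : ℕ → Type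
  | const {d : ℕ} (k : ℕ) : Term d
  | var {d : ℕ} (j : Fin d) : Term d
  | inp {d : ℕ} (m : Fin 3) (a : Term d) : Term d
  | add {d : ℕ} (a b : Term d) : Term d
  | sub {d : ℕ} (a b : Term d) : Term d
  | sum {d : ℕ} (a : Term (d + 1)) : Term d

/-- The value of a term. -/
def Term.eval (s : State) : {d : ℕ} → Term d → (Fin d → ℕ) → ℕ
  | _, .const k, _ => k
  | _, .var j, e => e j
  | _, .inp m a, e => s (m + 1) (a.eval s e)
  | _, .add a b, e => a.eval s e + b.eval s e
  | _, .sub a b, e => a.eval s e - b.eval s e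
  | _, .sum a, e => ∑ i ∈ Finset.range (s 1 0), a.eval s (Fin.snoc (α := fun _ => ℕ) e i)

/-- The content of a fixed cell. -/
abbrev Expr.cell (m i : ℕ) : Expr := .load m (.const i)

/-- A program that runs `P` for the values below the content of cell `0` of memory `1` in cell `d`
of memory `4`. -/
def Prog.forEach (d : ℕ) (P : Prog) : Prog :=
  .seq (.store 4 (.const d) (.const 0))
    (.loop (.sub (.cell 1 0) (.cell 4 d))
      (.seq P (.store 4 (.const d) (.add (.cell 4 d) (.const 1)))))

/-- The program that evaluates a term. The values of the variables are in memory `4`; the result is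
written into cell `h` of memory `5`, whose earlier cells are preserved. -/
def Term.prog : {d : ℕ} → Term d → ℕ → Prog
  | _, .const k, h => .store 5 (.const h) (.const k)
  | _, .var j, h => .store 5 (.const h) (.cell 4 j)
  | _, .inp m a, h => .seq (a.prog h) (.store 5 (.const h) (.load (m + 1) (.cell 5 h)))
  | _, .add a b, h => .seq (a.prog h) (.seq (b.prog (h + 1))
      (.store 5 (.const h) (.add (.cell 5 h) (.cell 5 (h + 1)))))
  | _, .sub a b, h => .seq (a.prog h) (.seq (b.prog (h + 1))
      (.store 5 (.const h) (.sub (.cell 5 h) (.cell 5 (h + 1)))))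
  | d, .sum a, h => .seq (.store 5 (.const h) (.const 0))
      (.forEach d (.seq (a.prog (h + 1))
        (.store 5 (.const h) (.add (.cell 5 h) (.cell 5 (h + 1))))))

/-- The range of the sums and the sizes of the numbers in the input memories are at most `L`. -/
structure Bounded (L : ℕ) (s : State) : Prop where
  count : s 1 0 ≤ L
  size : ∀ m : Fin 3, ∀ i, Nat.size (s (m + 1) i) ≤ L

theorem size_add_le (a b : ℕ) : Nat.size (a + b) ≤ Nat.size a + Nat.size b + 1 := by
  rw [Nat.size_le]
  have ha := Nat.lt_size_self a
  have hb := Nat.lt_size_self b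
  have h₁ : 2 ^ a.size ≤ 2 ^ (a.size + b.size) := Nat.pow_le_pow_right two_pos (by omega)
  have h₂ : 2 ^ b.size ≤ 2 ^ (a.size + b.size) := Nat.pow_le_pow_right two_pos (by omega)
  rw [pow_succ]
  omega

theorem size_le_self (a : ℕ) : Nat.size a ≤ a := Nat.size_le.2 Nat.lt_two_pow_self

theorem size_sum_le {n L B : ℕ} {f : ℕ → ℕ} (hn : n ≤ L) (hf : ∀ i < n, Nat.size (f i) ≤ B) :
    Nat.size (∑ i ∈ Finset.range n, f i) ≤ L + B := by
  rw [Nat.size_le]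
  have h : ∑ i ∈ Finset.range n, f i ≤ n * 2 ^ B := by
    simpa using Finset.sum_le_card_nsmul (Finset.range n) f (2 ^ B) fun i hi =>
      (Nat.size_le.1 (hf i (Finset.mem_range.1 hi))).le
  calc _ ≤ n * 2 ^ B := h
    _ < 2 ^ L * 2 ^ B := Nat.mul_lt_mul_of_pos_right (hn.trans_lt Nat.lt_two_pow_self) (by positivity)
    _ = _ := (pow_add ..).symm

theorem snoc_size_le {d L i : ℕ} {e : Fin d → ℕ} (he : ∀ j, Nat.size (e j) ≤ L) (hi : i ≤ L) :
    ∀ j, Nat.size (Fin.snoc (α := fun _ => ℕ) e i j) ≤ L := by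
  intro j
  refine Fin.lastCases ?_ (fun j => ?_) j
  · simpa using (size_le_self i).trans hi
  · simpa using he j

/-- Under logarithmic cost the intermediate values must stay short. A sum has at most `L` summands,
so it adds at most `L` digits, and the nesting depth depends on the term alone. -/
theorem Term.exists_size_le {d : ℕ} (t : Term d) : ∃ p : Polynomial ℕ, ∀ (L : ℕ) (s : State)
    (e : Fin d → ℕ), Bounded L s → (∀ j, Nat.size (e j) ≤ L) → Nat.size (t.eval s e) ≤ p.eval L := by
  induction t with
  | const k => exact ⟨.C (Nat.size k), fun L s e _ _ => by simp [eval]⟩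
  | var j => exact ⟨.X, fun L s e _ he => by simpa [eval] using he j⟩
  | inp m a _ => exact ⟨.X, fun L s e hs he => by simpa [eval] using hs.size m _⟩
  | add a b iha ihb =>
    obtain ⟨p, hp⟩ := iha
    obtain ⟨q, hq⟩ := ihb
    refine ⟨p + q + 1, fun L s e hs he => ?_⟩
    have := hp L s e hs he
    have := hq L s e hs he
    have := size_add_le (a.eval s e) (b.eval s e)
    simp only [eval, Polynomial.eval_add, Polynomial.eval_one]
    omega
  | sub a b iha _ =>
    obtain ⟨p, hp⟩ := iha
    exact ⟨p, fun L s e hs he => (Nat.size_le_size (Nat.sub_le _ _)).trans (hp L s e hs he)⟩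
  | sum a iha =>
    obtain ⟨p, hp⟩ := iha
    refine ⟨.X + p, fun L s e hs he => ?_⟩
    simp only [eval, Polynomial.eval_add, Polynomial.eval_X]
    exact size_sum_le hs.count fun i hi => hp L s _ hs (snoc_size_le he (hi.le.trans hs.count))

/-- Running `forEach`: the time is bounded by a polynomial if the time of the body is. -/
theorem exec_forEach {d L n T : ℕ} {P : Prog} (I : ℕ → State → Prop)
    (hn : n ≤ L) (hI : ∀ i s, I i s → s 1 0 = n)
    (hbody : ∀ i s, i < n → I i s → s 4 d = i → ∃ t s', Exec P s t s' ∧ t ≤ T ∧ s' 4 d = i ∧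
      I (i + 1) (Function.update s' 4 (Function.update (s' 4) d (i + 1))))
    (s : State) (hs : I 0 (Function.update s 4 (Function.update (s 4) d 0))) :
    ∃ t s', Exec (.forEach d P) s t s' ∧
      t ≤ 4 + Nat.size d + (L + 1) * (T + 20 + 3 * Nat.size d + 5 * L) ∧ I n s' := by
  have hsz {k : ℕ} (h : k ≤ n) : Nat.size k ≤ L := (size_le_self k).trans (h.trans hn)
  have hloop : ∀ k i s, i + k = n → I i s → s 4 d = i → ∃ t s',
      Exec (.loop (.sub (.cell 1 0) (.cell 4 d))
        (.seq P (.store 4 (.const d) (.add (.cell 4 d) (.const 1))))) s t s' ∧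
      t ≤ (k + 1) * (T + 20 + 3 * Nat.size d + 5 * L) ∧ I n s' := by
    intro k
    induction k with
    | zero =>
      intro i s hi hs hsi
      obtain rfl : i = n := by omega
      refine ⟨_, s, .loop_done ?_, ?_, hs⟩
      · simp [Expr.eval, hI _ _ hs, hsi]
      · have := hsz le_rfl
        simp [Expr.cost, Expr.eval, hI _ _ hs, hsi]
        omega
    | succ k ih =>
      intro i s hi hs hsi
      obtain ⟨t, s', hex, ht, hs'i, hs'⟩ := hbody i s (by omega) hs hsi
      have hst := Exec.store 4 (.const d) (.add (.cell 4 d) (.const 1)) s'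
      simp only [Expr.eval, hs'i] at hst
      obtain ⟨t', s'', hex', ht', hs''⟩ := ih (i + 1) _ (by omega) hs' (by simp)
      refine ⟨_, s'', .loop_step ?_ (.seq hex hst) hex', ?_, hs''⟩
      · simp [Expr.eval, hI _ _ hs, hsi]
        omega
      · have h₁ : Nat.size i ≤ L := hsz (by omega)
        have h₂ : Nat.size (i + 1) ≤ L := hsz (by omega)
        have h₃ : Nat.size (n - i) ≤ L := hsz (by omega)
        have h₄ : Nat.size n ≤ L := hsz le_rfl
        simp [Expr.cost, Expr.eval, hI _ _ hs, hsi, hs'i]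
        rw [add_mul (k + 1) 1]
        omega
  have hst := Exec.store 4 (.const d) (.const 0) s
  simp only [Expr.eval] at hst
  obtain ⟨t, s', hex, ht, hs'⟩ := hloop n 0 _ (by omega) hs (by simp)
  refine ⟨_, s', .seq hst hex, ?_, hs'⟩
  have : (n + 1) * (T + 20 + 3 * Nat.size d + 5 * L) ≤
    (L + 1) * (T + 20 + 3 * Nat.size d + 5 * L) := Nat.mul_le_mul_right _ (by omega)
  simp [Expr.cost]
  omega

/-- The state `s'` differs from `s` only in the cells of memory `4` from `d` on and of memory `5`
from `h` on. -/
structure SameBelow (d h : ℕ) (s s' : State) : Prop where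
  other : ∀ m, m ≠ 4 → m ≠ 5 → s' m = s m
  var : ∀ j < d, s' 4 j = s 4 j
  val : ∀ j < h, s' 5 j = s 5 j

theorem SameBelow.trans {d h d' h' : ℕ} {s s' s'' : State} (h₁ : SameBelow d h s s')
    (h₂ : SameBelow d' h' s' s'') (hd : d ≤ d') (hh : h ≤ h') : SameBelow d h s s'' :=
  ⟨fun m h₄ h₅ => (h₂.other m h₄ h₅).trans (h₁.other m h₄ h₅),
    fun j hj => (h₂.var j (hj.trans_le hd)).trans (h₁.var j hj),
    fun j hj => (h₂.val j (hj.trans_le hh)).trans (h₁.val j hj)⟩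

theorem SameBelow.update_val {d h : ℕ} (s : State) (k : ℕ) :
    SameBelow d h s (Function.update s 5 (Function.update (s 5) h k)) :=
  ⟨fun m _ h₅ => by simp [h₅], fun j _ => by simp, fun j hj => by simp [hj.ne]⟩

theorem SameBelow.update_var {d h : ℕ} (s : State) (k : ℕ) :
    SameBelow d h s (Function.update s 4 (Function.update (s 4) d k)) :=
  ⟨fun m h₄ _ => by simp [h₄], fun j hj => by simp [hj.ne], fun j hj => by simp⟩

theorem SameBelow.input {d h : ℕ} {s s' : State} (hs : SameBelow d h s s') (m : Fin 3) :
    s' (m + 1) = s (m + 1) :=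
  hs.other _ (by omega) (by omega)

theorem SameBelow.bounded {d h L : ℕ} {s s' : State} (hs : SameBelow d h s s')
    (hb : Bounded L s) : Bounded L s' :=
  ⟨by simpa [hs.other 1] using hb.count, fun m i => by rw [hs.input]; exact hb.size m i⟩

/-- Terms read only the three input memories, so scratch work and output written in between do not
change their values. -/
theorem Term.eval_congr {d : ℕ} (t : Term d) {s s' : State} (h : ∀ m : Fin 3, s' (m + 1) = s (m + 1))
    (e : Fin d → ℕ) : t.eval s' e = t.eval s e := by
  induction t with
  | const k => rfl
  | var j => rfl
  | inp m a ih => simp only [eval, ih, h]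
  | add a b iha ihb => simp only [eval, iha, ihb]
  | sub a b iha ihb => simp only [eval, iha, ihb]
  | sum a ih =>
    have := h 0
    simp only [Fin.val_zero, zero_add] at this
    simp only [eval, ih, this]

/-- The values of the first `d` variables in a state. -/
def State.vars (d : ℕ) (s : State) : Fin d → ℕ := fun j => s 4 j

theorem SameBelow.vars {d h : ℕ} {s s' : State} (hs : SameBelow d h s s') :
    s'.vars d = s.vars d := funext fun j => hs.var j j.2


theorem mul_eval_le (T L a b c : ℕ) (p : Polynomial ℕ) (hT : T ≤ p.eval L) :
    a + (L + 1) * (T + b + c * L) ≤ (.C a + (.X + 1) * (p + .C b + .C c * .X) :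
      Polynomial ℕ).eval L := by
  simp only [Polynomial.eval_add, Polynomial.eval_mul, Polynomial.eval_C, Polynomial.eval_X,
    Polynomial.eval_one]
  gcongr

/-- The program of a term is correct and runs in polynomial time. -/
theorem Term.exists_exec_prog {d : ℕ} (t : Term d) : ∀ h : ℕ, ∃ p : Polynomial ℕ,
    ∀ (L : ℕ) (s : State), Bounded L s → (∀ j, Nat.size (s.vars d j) ≤ L) →
      ∃ T s', Exec (t.prog h) s T s' ∧ T ≤ p.eval L ∧ s' 5 h = t.eval s (s.vars d) ∧
        SameBelow d h s s' := by
  induction t with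
  | const k =>
    intro h
    exact ⟨.C (1 + Nat.size h + (1 + Nat.size k) + 1), fun L s _ _ =>
      ⟨_, _, .store 5 (.const h) (.const k) s, by simp [Expr.cost], by simp [Expr.eval, eval],
        .update_val s k⟩⟩
  | var j =>
    intro h
    refine ⟨.C (4 + Nat.size h + Nat.size (j : ℕ)) + .X, fun L s _ hv =>
      ⟨_, _, .store 5 (.const h) (.cell 4 j) s, ?_, by simp [Expr.eval, eval, State.vars],
        .update_val s _⟩⟩
    have := hv j
    simp only [State.vars] at this
    simp [Expr.cost, Expr.eval]
    omega
  | inp m a ih =>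
    intro h
    obtain ⟨p, hp⟩ := ih h
    obtain ⟨q, hq⟩ := a.exists_size_le
    refine ⟨p + q + .X + .C (20 + 2 * Nat.size h), fun L s hs hv => ?_⟩
    obtain ⟨T, s', hex, hT, hval, hsame⟩ := hp L s hs hv
    refine ⟨_, _, .seq hex (.store 5 (.const h) (.load (m + 1) (.cell 5 h)) s'), ?_, ?_,
      hsame.trans (.update_val s' _) le_rfl le_rfl⟩
    · have h₁ := hq L s _ hs hv
      have h₂ := hs.size m (a.eval s (s.vars _))
      simp [Expr.cost, Expr.eval, hval, hsame.input]
      omega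
    · simp [Expr.eval, eval, hval, hsame.input]
  | add a b iha ihb =>
    intro h
    obtain ⟨p, hp⟩ := iha h
    obtain ⟨p', hp'⟩ := ihb (h + 1)
    obtain ⟨q, hq⟩ := a.exists_size_le
    obtain ⟨q', hq'⟩ := b.exists_size_le
    refine ⟨p + p' + 2 * q + 2 * q' + .C (20 + 2 * Nat.size h + Nat.size (h + 1)),
      fun L s hs hv => ?_⟩
    obtain ⟨T, s', hex, hT, hval, hsame⟩ := hp L s hs hv
    obtain ⟨T', s'', hex', hT', hval', hsame'⟩ := hp' L s' (hsame.bounded hs)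
      (by rwa [hsame.vars])
    rw [b.eval_congr hsame.input, hsame.vars] at hval'
    -- Memory `5` acts as a stack: `b` is evaluated one cell higher, so the value of `a` in cell `h`
    -- survives.
    have hval'' := (hsame'.val h (by omega)).trans hval
    refine ⟨_, _, .seq hex (.seq hex' (.store 5 (.const h)
      (.add (.cell 5 h) (.cell 5 (h + 1))) s'')), ?_, ?_,
      (hsame.trans hsame' le_rfl (by omega)).trans (.update_val s'' _) le_rfl le_rfl⟩
    · have h₁ := hq L s _ hs hv
      have h₂ := hq' L s _ hs hv
      have h₃ := size_add_le (a.eval s (s.vars _)) (b.eval s (s.vars _))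
      simp [Expr.cost, Expr.eval, hval', hval'']
      omega
    · simp [Expr.eval, eval, hval', hval'']
  | sub a b iha ihb =>
    intro h
    obtain ⟨p, hp⟩ := iha h
    obtain ⟨p', hp'⟩ := ihb (h + 1)
    obtain ⟨q, hq⟩ := a.exists_size_le
    obtain ⟨q', hq'⟩ := b.exists_size_le
    refine ⟨p + p' + 2 * q + 2 * q' + .C (20 + 2 * Nat.size h + Nat.size (h + 1)),
      fun L s hs hv => ?_⟩
    obtain ⟨T, s', hex, hT, hval, hsame⟩ := hp L s hs hv
    obtain ⟨T', s'', hex', hT', hval', hsame'⟩ := hp' L s' (hsame.bounded hs)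
      (by rwa [hsame.vars])
    rw [b.eval_congr hsame.input, hsame.vars] at hval'
    have hval'' := (hsame'.val h (by omega)).trans hval
    refine ⟨_, _, .seq hex (.seq hex' (.store 5 (.const h)
      (.sub (.cell 5 h) (.cell 5 (h + 1))) s'')), ?_, ?_,
      (hsame.trans hsame' le_rfl (by omega)).trans (.update_val s'' _) le_rfl le_rfl⟩
    · have h₁ := hq L s _ hs hv
      have h₂ := hq' L s _ hs hv
      have h₃ : Nat.size (a.eval s (s.vars _) - b.eval s (s.vars _)) ≤ _ :=
        Nat.size_le_size (Nat.sub_le _ _)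
      simp [Expr.cost, Expr.eval, hval', hval'']
      omega
    · simp [Expr.eval, eval, hval', hval'']
  | @sum d a ih =>
    intro h
    obtain ⟨p, hp⟩ := ih (h + 1)
    obtain ⟨q, hq⟩ := a.exists_size_le
    refine ⟨.C (20 + Nat.size h + Nat.size d) + (.X + 1) * (p + 4 * q + .C (50 + 2 * Nat.size h +
      Nat.size (h + 1) + 3 * Nat.size d) + .C 7 * .X), fun L s hs hv => ?_⟩
    let f : ℕ → ℕ := fun i => a.eval s (Fin.snoc (α := fun _ => ℕ) (s.vars d) i)
    obtain ⟨T, s', hex, hT, hsame, hval⟩ := exec_forEach (L := L)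
      (T := p.eval L + 4 * q.eval L + (30 + 2 * Nat.size h + Nat.size (h + 1)) + 2 * L)
      (d := d) (n := s 1 0)
      (P := .seq (a.prog (h + 1)) (.store 5 (.const h) (.add (.cell 5 h) (.cell 5 (h + 1)))))
      -- Cell `h` accumulates the partial sum. The loop counter is cell `d` of memory `4`, which
      -- `SameBelow d h` leaves free, so incrementing it keeps the invariant.
      (fun i s' => SameBelow d h s s' ∧ s' 5 h = ∑ k ∈ Finset.range i, f k) hs.count
      (fun i s' hi => by rw [hi.1.other 1 (by omega) (by omega)]) (by
        rintro i s₁ hi ⟨hsame, hval⟩ hsi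
        have hvars : s₁.vars (d + 1) = Fin.snoc (α := fun _ => ℕ) (s.vars d) i := by
          funext j
          refine Fin.lastCases ?_ (fun j => ?_) j
          · simpa [State.vars] using hsi
          · simpa [State.vars] using hsame.var j j.2
        have hsnoc := snoc_size_le hv (hi.le.trans hs.count)
        obtain ⟨T, s₂, hex, hT, hval', hsame'⟩ := hp L s₁ (hsame.bounded hs)
          (by rwa [hvars])
        rw [a.eval_congr hsame.input, hvars] at hval'
        have hval'' := (hsame'.val h (by omega)).trans hval
        refine ⟨_, _, .seq hex (.store 5 (.const h) (.add (.cell 5 h) (.cell 5 (h + 1))) s₂),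
          ?_, ?_, ?_, ?_⟩
        · have h₁ : Nat.size (∑ k ∈ Finset.range i, f k) ≤ L + q.eval L :=
            size_sum_le (hi.le.trans hs.count) fun k hk =>
              hq L s _ hs (snoc_size_le hv ((hk.trans hi).le.trans hs.count))
          have h₂ := hq L s _ hs hsnoc
          have h₃ := size_add_le (∑ k ∈ Finset.range i, f k)
            (a.eval s (Fin.snoc (α := fun _ => ℕ) (s.vars d) i))
          simp [Expr.cost, Expr.eval, hval', hval'']
          omega
        · simpa [hsi] using hsame'.var d (by omega)
        · exact ((hsame.trans hsame' (by omega) (by omega)).trans (.update_val s₂ _) le_rfl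
            le_rfl).trans (.update_var _ _) le_rfl le_rfl
        · simp [Expr.eval, hval', hval'', Finset.sum_range_succ, f])
      (Function.update s 5 (Function.update (s 5) h 0))
      ⟨(SameBelow.update_val s 0).trans (.update_var _ _) le_rfl le_rfl, by simp⟩
    refine ⟨_, s', .seq (.store 5 (.const h) (.const 0) s) hex, ?_, hval, hsame⟩
    have := mul_eval_le (p.eval L + 4 * q.eval L) L (20 + Nat.size h + Nat.size d)
      (50 + 2 * Nat.size h + Nat.size (h + 1) + 3 * Nat.size d) 7 (p + 4 * q) (by simp)
    refine le_trans ?_ this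
    have e : p.eval L + 4 * q.eval L + (30 + 2 * Nat.size h + Nat.size (h + 1)) + 2 * L + 20 +
      3 * Nat.size d + 5 * L = p.eval L + 4 * q.eval L + (50 + 2 * Nat.size h +
      Nat.size (h + 1) + 3 * Nat.size d) + 7 * L := by omega
    rw [e] at hT
    simp [Expr.cost]
    omega

/-- The program that writes the value of `a` and the values of `b` at the numbers below the content
of cell `0` of memory `1` into memory `0`. -/
def outputProg (a : Term 0) (b : Term 1) : Prog :=
  .seq (.seq (a.prog 0) (.store 0 (.const 0) (.cell 5 0)))
    (.forEach 0 (.seq (b.prog 0) (.store 0 (.add (.cell 4 0) (.const 1)) (.cell 5 0))))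

theorem exists_exec_outputProg (a : Term 0) (b : Term 1) : ∃ p : Polynomial ℕ,
    ∀ (L : ℕ) (s : State), Bounded L s → s 0 = memOf [] →
      ∃ T s', Exec (outputProg a b) s T s' ∧ T ≤ p.eval L ∧
        s' 0 = memOf (a.eval s Fin.elim0 ::
          List.ofFn fun i : Fin (s 1 0) => b.eval s fun _ => (i : ℕ)) := by
  obtain ⟨p, hp⟩ := a.exists_exec_prog 0
  obtain ⟨q, hq⟩ := a.exists_size_le
  obtain ⟨p', hp'⟩ := b.exists_exec_prog 0
  obtain ⟨q', hq'⟩ := b.exists_size_le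
  refine ⟨p + q + (.C 20 + (.X + 1) * (p' + q' + .C 50 + .C 7 * .X)), fun L s hs hs0 => ?_⟩
  obtain ⟨T, s₁, hex, hT, hval, hsame⟩ := hp L s hs (fun j => j.elim0)
  have hvars : s.vars 0 = Fin.elim0 := funext fun j => j.elim0
  rw [hvars] at hval
  -- Memory `0` after `i` rounds; the value of `b` at `j - 1` sits in cell `j` because cell `0`
  -- holds the value of `a`.
  let out : ℕ → ℕ → ℕ := fun i j =>
    if j = 0 then a.eval s Fin.elim0 else if j ≤ i then b.eval s fun _ => j - 1 else 0
  let s₂ := Function.update s₁ 0 (Function.update (s₁ 0) 0 (a.eval s Fin.elim0))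
  have hstore := Exec.store 0 (.const 0) (.cell 5 0) s₁
  simp only [Expr.eval, hval] at hstore
  obtain ⟨T', s', hex', hT', hinp, hout⟩ := exec_forEach (L := L)
    (T := p'.eval L + q'.eval L + 30 + 2 * L) (d := 0) (n := s 1 0)
    (P := .seq (b.prog 0) (.store 0 (.add (.cell 4 0) (.const 1)) (.cell 5 0)))
    (fun i s' => (∀ m : Fin 3, s' (m + 1) = s (m + 1)) ∧ s' 0 = out i) hs.count
    (fun i s' hi => by rw [show s' 1 = s 1 from hi.1 0]) (by
      rintro i s₃ hi ⟨hinp, hout⟩ hsi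
      have hb : Bounded L s₃ := ⟨by rw [show s₃ 1 = s 1 from hinp 0]; exact hs.count,
        fun m i => by rw [hinp]; exact hs.size m i⟩
      have hi' : Nat.size i ≤ L := (size_le_self i).trans (hi.le.trans hs.count)
      have hi'' : Nat.size (i + 1) ≤ L :=
        (size_le_self _).trans (Nat.succ_le_of_lt (hi.trans_le hs.count))
      have hvars : s₃.vars 1 = fun _ => i := by
        funext j
        rw [Subsingleton.elim j 0]
        exact hsi
      obtain ⟨T, s₄, hex, hT, hval, hsame⟩ := hp' L s₃ hb (fun j => by rwa [hvars])
      rw [b.eval_congr hinp, hvars] at hval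
      have hv := (hsame.var 0 one_pos).trans hsi
      refine ⟨_, _, .seq hex (.store 0 (.add (.cell 4 0) (.const 1)) (.cell 5 0) s₄), ?_, ?_, ?_,
        ?_⟩
      · have h₁ := hq' L s (fun _ => i) hs (fun _ => hi')
        simp [Expr.cost, Expr.eval, hv, hval]
        omega
      · simpa using hv
      · intro m
        rw [Function.update_of_ne (by omega), Function.update_of_ne (by omega), hsame.input, hinp]
      · funext j
        have h₀ := congr_fun ((hsame.other 0 (by omega) (by omega)).trans hout) j
        by_cases hj : j = i + 1
        · subst hj
          simp [Expr.eval, hv, hval, out]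
        · simp only [Expr.eval, hv, hval, ne_eq, OfNat.zero_ne_ofNat, not_false_eq_true,
            Function.update_of_ne, Function.update_self, hj, h₀, out]
          split_ifs <;> first | rfl | omega)
    s₂ ⟨fun m => by
      rw [Function.update_of_ne (by omega)]
      exact (Function.update_of_ne (by omega) _ _).trans (hsame.input m), by
      funext j
      have h₀ := congr_fun (hsame.other 0 (by omega) (by omega)) j
      rw [hs0] at h₀
      by_cases hj : j = 0
      · simp [s₂, out, hj]
      · simp [s₂, out, hj, h₀, memOf]⟩
  refine ⟨_, s', .seq (.seq hex hstore) hex', ?_, ?_⟩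
  · have h₁ := hq L s Fin.elim0 hs (fun j => j.elim0)
    have := mul_eval_le (p'.eval L + q'.eval L) L 4 50 7 (p' + q') (by simp)
    rw [show p'.eval L + q'.eval L + 30 + 2 * L + 20 + 3 * Nat.size 0 + 5 * L =
      p'.eval L + q'.eval L + 50 + 7 * L by simp; omega] at hT'
    simp [Expr.cost, Expr.eval, hval] at this hT' ⊢
    omega
  · rw [hout]
    funext j
    cases j with
    | zero => simp [out, memOf]
    | succ j =>
      by_cases hj : j < s 1 0
      · simp [out, memOf, Nat.succ_le_of_lt hj]
      · simp [out, memOf, hj]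

end RAM

/-! ### Distances and components in `P_6`-free graphs -/

namespace SimpleGraph

variable {V : Type*} {G : SimpleGraph V}

theorem IsInducedFree.not_inducedPathSix (hP : IsInducedFree (pathGraph 6) G) {a b c d e f : V}
    (ab : G.Adj a b) (bc : G.Adj b c) (cd : G.Adj c d) (de : G.Adj d e) (ef : G.Adj e f)
    (ac : ¬ G.Adj a c) (ad : ¬ G.Adj a d) (ae : ¬ G.Adj a e) (af : ¬ G.Adj a f)
    (bd : ¬ G.Adj b d) (be : ¬ G.Adj b e) (bf : ¬ G.Adj b f)
    (ce : ¬ G.Adj c e) (cf : ¬ G.Adj c f) (df : ¬ G.Adj d f) : False := by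
  have key : ∀ i j : Fin 6, G.Adj (![a, b, c, d, e, f] i) (![a, b, c, d, e, f] j) ↔
      (pathGraph 6).Adj i j := by
    intro i j
    rw [pathGraph_adj]
    fin_cases i <;> fin_cases j <;>
      simp [ab, bc, cd, de, ef, ac, ad, ae, af, bd, be, bf, ce, cf, df, G.adj_comm]
  refine hP ⟨⟨⟨![a, b, c, d, e, f], fun i j hij => ?_⟩, fun {i j} => key i j⟩⟩
  -- No two vertices of `P_6` have the same neighbourhood, so injectivity follows from the
  -- adjacencies.
  have h : ∀ k, (pathGraph 6).Adj i k ↔ (pathGraph 6).Adj j k := fun k => by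
    rw [← key, ← key, hij]
  simp only [pathGraph_adj] at h
  revert h
  clear hij
  revert i j
  decide

/-- A vertex dominates itself and its neighbours. -/
def Dom (G : SimpleGraph V) (a b : V) : Prop := a = b ∨ G.Adj a b

/-- The two vertices have distance at most two. -/
def Near2 (G : SimpleGraph V) (a b : V) : Prop := ∃ c, G.Dom a c ∧ G.Dom c b

/-- The two vertices have distance at most four. -/
def Near4 (G : SimpleGraph V) (a b : V) : Prop := ∃ c, G.Near2 a c ∧ G.Near2 c b

theorem Dom.refl (a : V) : G.Dom a a := .inl rfl
theorem Dom.symm {a b : V} (h : G.Dom a b) : G.Dom b a := h.imp Eq.symm Adj.symm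
theorem Adj.dom {a b : V} (h : G.Adj a b) : G.Dom a b := .inr h
theorem Near2.symm {a b : V} : G.Near2 a b → G.Near2 b a :=
  fun ⟨c, h, h'⟩ => ⟨c, h'.symm, h.symm⟩
theorem Near4.symm {a b : V} : G.Near4 a b → G.Near4 b a :=
  fun ⟨c, h, h'⟩ => ⟨c, h'.symm, h.symm⟩
theorem Near2.refl (a : V) : G.Near2 a a := ⟨a, .refl a, .refl a⟩
theorem Near4.refl (a : V) : G.Near4 a a := ⟨a, .refl a, .refl a⟩
theorem Dom.near2 {a b : V} (h : G.Dom a b) : G.Near2 a b := ⟨b, h, .refl b⟩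
theorem Near2.near4 {a b : V} (h : G.Near2 a b) : G.Near4 a b := ⟨b, h, .refl b⟩
theorem Near4.of_dom {a b c d e : V} (h₁ : G.Dom a b) (h₂ : G.Dom b c) (h₃ : G.Dom c d)
    (h₄ : G.Dom d e) : G.Near4 a e := ⟨c, ⟨b, h₁, h₂⟩, ⟨d, h₃, h₄⟩⟩

/-- If `b` were farther than four from `u`, the walk of five edges from `u` through `a` to `b` would
be an induced `P_6`: any chord or repetition gives a walk of length at most four. So `Near4` is the
relation of lying in the same component. -/
theorem Near4.trans_adj (hP : IsInducedFree (pathGraph 6) G) {u a b : V} (h : G.Near4 u a)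
    (hab : G.Adj a b) : G.Near4 u b := by
  by_contra hn
  obtain ⟨y, ⟨x, h₁, h₂⟩, ⟨z, h₃, h₄⟩⟩ := h
  have sc : ∀ {p q r : V}, G.Dom u p → G.Dom p q → G.Dom q r → G.Dom r b → False :=
    fun k₁ k₂ k₃ k₄ => hn (.of_dom k₁ k₂ k₃ k₄)
  have r : ∀ x, G.Dom x x := .refl
  have d := hab.dom
  rcases id h₁ with rfl | h₁'
  · exact sc h₂ h₃ h₄ d
  rcases id h₂ with rfl | h₂'
  · exact sc h₁ h₃ h₄ d
  rcases id h₃ with rfl | h₃'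
  · exact sc h₁ h₂ h₄ d
  rcases id h₄ with rfl | h₄'
  · exact sc h₁ h₂ h₃ d
  exact hP.not_inducedPathSix h₁' h₂' h₃' h₄' hab
    (fun k => sc k.dom h₃ h₄ d) (fun k => sc (r _) k.dom h₄ d) (fun k => sc (r _) (r _) k.dom d)
    (fun k => sc (r _) (r _) (r _) k.dom) (fun k => sc h₁ k.dom h₄ d)
    (fun k => sc h₁ k.dom (r _) d) (fun k => sc h₁ (r _) (r _) k.dom)
    (fun k => sc h₁ h₂ k.dom d) (fun k => sc (r _) h₁ h₂ k.dom) (fun k => sc h₁ h₂ h₃ k.dom)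

theorem Near4.trans_dom (hP : IsInducedFree (pathGraph 6) G) {u a b : V} (h : G.Near4 u a)
    (hab : G.Dom a b) : G.Near4 u b := by
  rcases hab with rfl | hab
  · exact h
  · exact h.trans_adj hP hab

theorem Near4.trans (hP : IsInducedFree (pathGraph 6) G) {u a b : V} (h : G.Near4 u a)
    (h' : G.Near4 a b) : G.Near4 u b := by
  obtain ⟨y, ⟨x, h₁, h₂⟩, ⟨z, h₃, h₄⟩⟩ := h'
  exact (((h.trans_dom hP h₁).trans_dom hP h₂).trans_dom hP h₃).trans_dom hP h₄

/-- The set `D` dominates no vertex twice. -/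
theorem IsEfficientDominatingSet.eq_of_dom {D : Set V} (hD : G.IsEfficientDominatingSet D)
    {d d' y : V} (hd : d ∈ D) (hd' : d' ∈ D) (h : G.Dom d y) (h' : G.Dom d' y) : d = d' :=
  (hD y).unique ⟨hd, h⟩ ⟨hd', h'⟩

theorem IsEfficientDominatingSet.exists_dom {D : Set V} (hD : G.IsEfficientDominatingSet D)
    (y : V) : ∃ d ∈ D, G.Dom d y :=
  (hD y).exists

end SimpleGraph

/-! ### The second neighbourhood of `v` and shadowing -/

namespace SimpleGraph

variable {V : Type*} {G : SimpleGraph V}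

/-- The two vertices have distance exactly two. -/
def AtTwo (G : SimpleGraph V) (v x : V) : Prop := G.Near2 v x ∧ ¬ G.Dom v x

theorem AtTwo.exists_adj {v x : V} (h : G.AtTwo v x) : ∃ a, G.Adj v a ∧ G.Adj a x := by
  obtain ⟨⟨c, h₁, h₂⟩, h₃⟩ := h
  rcases id h₁ with rfl | h₁'
  · exact absurd h₂ h₃
  rcases h₂ with rfl | h₂
  · exact absurd h₁ h₃
  · exact ⟨c, h₁', h₂⟩

theorem AtTwo.not_adj {v x : V} (h : G.AtTwo v x) : ¬ G.Adj v x := fun k => h.2 (.inr k)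

theorem not_adj_of_not_near2 {v w : V} (h : ¬ G.Near2 v w) : ¬ G.Adj v w :=
  fun k => h k.dom.near2

theorem not_adj_of_adj_of_not_near2 {v a w : V} (h : ¬ G.Near2 v w) (ha : G.Adj v a) :
    ¬ G.Adj a w :=
  fun k => h ⟨a, ha.dom, k.dom⟩

/-- A path `v, a, x, p` that leaves the second neighbourhood of `v` at `x` cannot be continued by
two vertices not adjacent to `x`. -/
theorem IsInducedFree.adj_of_atTwo (hP : IsInducedFree (pathGraph 6) G) {v x p q r : V}
    (hx : G.AtTwo v x) (hp : ¬ G.Near2 v p) (hq : ¬ G.Near2 v q) (hr : ¬ G.Near2 v r)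
    (xp : G.Adj x p) (pq : G.Adj p q) (qr : G.Adj q r) (xq : ¬ G.Adj x q) (xr : ¬ G.Adj x r) :
    G.Adj p r := by
  by_contra pr
  obtain ⟨a, va, ax⟩ := hx.exists_adj
  exact hP.not_inducedPathSix va ax xp pq qr hx.not_adj (not_adj_of_not_near2 hp)
    (not_adj_of_not_near2 hq) (not_adj_of_not_near2 hr) (not_adj_of_adj_of_not_near2 hp va)
    (not_adj_of_adj_of_not_near2 hq va) (not_adj_of_adj_of_not_near2 hr va) xq xr pr

/-- Two nonadjacent vertices at distance two from `v` with private neighbours `p` and `q` far from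
`v`: every further neighbour of `q` far from `v` is seen by one of the other three. -/
theorem IsInducedFree.not_private_pair (hP : IsInducedFree (pathGraph 6) G) {v x y p q r : V}
    (hx : G.AtTwo v x) (hy : G.AtTwo v y) (hp : ¬ G.Near2 v p) (hq : ¬ G.Near2 v q)
    (hr : ¬ G.Near2 v r) (xy : ¬ G.Adj x y) (xp : G.Adj x p) (yq : G.Adj y q) (qr : G.Adj q r)
    (py : ¬ G.Adj p y) (xq : ¬ G.Adj x q) (pq : ¬ G.Adj p q) (pr : ¬ G.Adj p r)
    (xr : ¬ G.Adj x r) (yr : ¬ G.Adj y r) : False := by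
  obtain ⟨a, va, ax⟩ := hx.exists_adj
  obtain ⟨b, vb, yb⟩ := hy.exists_adj
  have n {a : V} (va : G.Adj v a) {w : V} (hw : ¬ G.Near2 v w) : ¬ G.Adj a w :=
    not_adj_of_adj_of_not_near2 hw va
  have n' {a : V} (va : G.Adj v a) {w : V} (hw : ¬ G.Near2 v w) : ¬ G.Adj w a :=
    fun k => n va hw k.symm
  have m {w : V} (hw : ¬ G.Near2 v w) : ¬ G.Adj w v := fun k => not_adj_of_not_near2 hw k.symm
  have hxv : ¬ G.Adj x v := fun k => hx.not_adj k.symm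
  -- `x` and `y` are joined by an induced path through `a`, through `b`, through `a, b`, or through
  -- `a, v, b`. Adding `p` at one end, and as much of `q, r` at the other as needed, gives an
  -- induced `P_6`.
  by_cases ay : G.Adj a y
  · exact hP.not_inducedPathSix xp.symm ax.symm ay yq qr (n' va hp) py pq pr xy xq xr
      (n va hq) (n va hr) yr
  by_cases xb : G.Adj x b
  · exact hP.not_inducedPathSix xp.symm xb yb yq qr (n' vb hp) py pq pr xy xq xr
      (n vb hq) (n vb hr) yr
  by_cases ab : G.Adj a b
  · exact hP.not_inducedPathSix xp.symm ax.symm ab yb yq (n' va hp) (n' vb hp) py pq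
      xb xy xq ay (n va hq) (n vb hq)
  · exact hP.not_inducedPathSix xp.symm ax.symm va.symm vb yb (n' va hp) (m hp) (n' vb hp) py
      hxv xb xy ab ay hy.not_adj

variable {v : V} {D : Set V}

theorem IsEfficientDominatingSet.not_near2 (hD : G.IsEfficientDominatingSet D) {d d' : V}
    (hd : d ∈ D) (hd' : d' ∈ D) (h : d ≠ d') : ¬ G.Near2 d d' :=
  fun ⟨_, h₁, h₂⟩ => h (hD.eq_of_dom hd hd' h₁ h₂.symm)

theorem IsEfficientDominatingSet.not_adj (hD : G.IsEfficientDominatingSet D) {d d' y : V}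
    (hd : d ∈ D) (hd' : d' ∈ D) (h : d ≠ d') (hy : G.Adj d y) : ¬ G.Adj d' y :=
  fun k => h (hD.eq_of_dom hd hd' hy.dom k.dom)

theorem AtTwo.ne_of_adj {d x : V} (hx : G.AtTwo v x) (h : G.Adj x d) : v ≠ d := by
  rintro rfl
  exact hx.not_adj h.symm

/-- `d'` shadows `d` (seen from `v`): a vertex at distance two from `v` that is dominated by `d`
sees everything in the neighbourhood of `d` far from `v` that is not in conflict with `d'`. -/
def Shadows (G : SimpleGraph V) (v d d' : V) : Prop :=
  d = d' ∨ ∀ x, G.AtTwo v x → G.Adj x d → ∀ w, ¬ G.Near2 v w → G.Adj d w →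
    G.Adj x w ∨ ∃ z, G.AtTwo v z ∧ G.Adj z d' ∧ G.Adj z w

theorem not_shadows {d d' : V} (h : ¬ G.Shadows v d d') : d ≠ d' ∧ ∃ x, G.AtTwo v x ∧
    G.Adj x d ∧ ∃ w, ¬ G.Near2 v w ∧ G.Adj d w ∧ ¬ G.Adj x w ∧
      ∀ z, G.AtTwo v z → G.Adj z d' → ¬ G.Adj z w := by
  unfold Shadows at h
  push Not at h
  exact h

variable (hP : IsInducedFree (pathGraph 6) G) (hD : G.IsEfficientDominatingSet D) (hv : v ∈ D)

-- Witnesses `x, w` and `y, u` against the two directions form the induced path `w, d, x, y, d', u`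
-- if `x` and `y` are adjacent, and the configuration of `not_private_pair` otherwise.
include hP hD hv in
theorem Shadows.total {d d' : V} (hd : d ∈ D) (hd' : d' ∈ D) :
    G.Shadows v d d' ∨ G.Shadows v d' d := by
  by_contra! h
  obtain ⟨h₁, h₂⟩ := h
  obtain ⟨ne, x, hx, xd, w, hw, dw, xw, hw'⟩ := not_shadows h₁
  obtain ⟨-, y, hy, yd', u, hu, du, yu, hu'⟩ := not_shadows h₂
  have vd := hD.not_near2 hv hd (hx.ne_of_adj xd)
  have vd' := hD.not_near2 hv hd' (hy.ne_of_adj yd')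
  have dd' : ¬ G.Adj d d' := fun k => hD.not_near2 hd hd' ne k.dom.near2
  have xd' : ¬ G.Adj x d' := fun k => hD.not_adj hd hd' ne xd.symm k.symm
  have dy : ¬ G.Adj d y := fun k => hD.not_adj hd hd' ne k yd'.symm
  have du' : ¬ G.Adj d u := fun k => hD.not_adj hd hd' ne k du
  have wd' : ¬ G.Adj w d' := fun k => hD.not_adj hd hd' ne dw k.symm
  have xu := hu' x hx xd
  have yw := hw' y hy yd'
  by_cases xy : G.Adj x y
  · have wu : ¬ G.Adj w u := fun k => du' (hP.adj_of_atTwo hx vd hw hu xd dw k xw xu)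
    exact hP.not_inducedPathSix dw.symm xd.symm xy yd' du (fun k => xw k.symm)
      (fun k => yw k.symm) wd' wu dy dd' du' xd' xu yu
  · exact hP.not_private_pair hx hy vd vd' hu xy xd yd' du dy xd' dd' du' xu yu

-- The form of transitivity needed for a maximum. A witness `u` against `a` shadowing `b` must be
-- seen by some `z` adjacent to `c`; together with a witness `x, w` against `c` shadowing `a` this
-- gives the induced path `w, a, x, z, u, b`, or `not_private_pair` if `x` and `z` are not adjacent.
include hP hD hv in
theorem Shadows.trans_of_not {a b c : V} (ha : a ∈ D) (hb : b ∈ D) (hc : c ∈ D)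
    (hbc : G.Shadows v b c) (hac : ¬ G.Shadows v a c) : G.Shadows v b a := by
  by_contra hba
  rcases id hbc with rfl | hbc'
  · exact hac ((Shadows.total hP hD hv ha hb).resolve_right hba)
  obtain ⟨ac, x, hx, xa, w, hw, aw, xw, hw'⟩ := not_shadows hac
  obtain ⟨ba, y, hy, yb, u, hu, bu, yu, hu'⟩ := not_shadows hba
  have bc : b ≠ c := by
    rintro rfl
    exact hac ((Shadows.total hP hD hv ha hb).resolve_right hba)
  obtain ⟨z, hz, zc, zu⟩ := (hbc' y hy yb u hu bu).resolve_left yu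
  have va := hD.not_near2 hv ha (hx.ne_of_adj xa)
  have vb := hD.not_near2 hv hb (hy.ne_of_adj yb)
  have vc := hD.not_near2 hv hc (hz.ne_of_adj zc)
  have xu := hu' x hx xa
  have zw := hw' z hz zc
  have az : ¬ G.Adj a z := fun k => hD.not_adj ha hc ac k zc.symm
  have xc : ¬ G.Adj x c := fun k => hD.not_adj ha hc ac xa.symm k.symm
  have ca : ¬ G.Adj c a := fun k => hD.not_near2 ha hc ac k.symm.dom.near2
  have cw : ¬ G.Adj c w := fun k => hD.not_adj ha hc ac aw k
  have au : ¬ G.Adj a u := fun k => hD.not_adj hb ha ba bu k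
  have ab : ¬ G.Adj a b := fun k => hD.not_near2 ha hb ba.symm k.dom.near2
  have xb : ¬ G.Adj x b := fun k => hD.not_adj ha hb ba.symm xa.symm k.symm
  have zb : ¬ G.Adj z b := fun k => hD.not_adj hc hb bc.symm zc.symm k.symm
  have wb : ¬ G.Adj w b := fun k => hD.not_adj ha hb ba.symm aw k.symm
  by_cases xz : G.Adj x z
  · have wu : ¬ G.Adj w u := fun k => au (hP.adj_of_atTwo hx va hw hu xa aw k xw xu)
    exact hP.not_inducedPathSix aw.symm xa.symm xz zu bu.symm (fun k => xw k.symm)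
      (fun k => zw k.symm) wu wb az au ab xu xb zb
  · exact hP.not_private_pair hz hx vc va hw (fun k => xz k.symm) zc xa aw
      (fun k => xc k.symm) (fun k => az k.symm) ca cw zw xw

include hP hD hv in
/-- Some vertex of `D` shadows all vertices of `D` in the component of `v`. -/
theorem exists_forall_shadows [Finite V] :
    ∃ e ∈ D, G.Near4 v e ∧ ∀ d ∈ D, G.Near4 v d → G.Shadows v d e := by
  classical
  have := Fintype.ofFinite V
  obtain ⟨e, he, hmax⟩ := (Finset.univ.filter fun d => d ∈ D ∧ G.Near4 v d).exists_max_image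
    (fun e => (Finset.univ.filter fun d => d ∈ D ∧ G.Shadows v d e).card)
    ⟨v, by simpa using ⟨hv, .refl v⟩⟩
  simp only [Finset.mem_filter, Finset.mem_univ, true_and] at he hmax
  refine ⟨e, he.1, he.2, fun d hd hvd => ?_⟩
  -- A vertex `d` not shadowed by `e` shadows all that `e` shadows and also itself, contradicting
  -- the maximality of `e`.
  by_contra hde
  refine absurd (hmax d ⟨hd, hvd⟩) (not_le.mpr (Finset.card_lt_card ?_))
  rw [Finset.ssubset_iff_of_subset]
  · exact ⟨d, by simpa using ⟨hd, .inl rfl⟩, by simp [hde]⟩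
  · intro b hb
    simp only [Finset.mem_filter, Finset.mem_univ, true_and] at hb ⊢
    exact ⟨hb.1, Shadows.trans_of_not hP hD hv hd hb.1 he.1 hb.2 hde⟩

/-! ### Links and the vertices touching them -/

/-- An induced path on four vertices far from `v` with both ends in `D`. -/
structure IsLink (G : SimpleGraph V) (D : Set V) (v p q r s : V) : Prop where
  hp : p ∈ D
  hs : s ∈ D
  ne : p ≠ s
  pq : G.Adj p q
  qr : G.Adj q r
  rs : G.Adj r s
  fp : ¬ G.Near2 v p
  fq : ¬ G.Near2 v q
  fr : ¬ G.Near2 v r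
  fs : ¬ G.Near2 v s

end SimpleGraph

namespace SimpleGraph

variable {V : Type*} {G : SimpleGraph V} {v : V} {D : Set V}

/-- The vertex `x` is adjacent to one of the four vertices. -/
def Touches (G : SimpleGraph V) (x p q r s : V) : Prop :=
  G.Adj x p ∨ G.Adj x q ∨ G.Adj x r ∨ G.Adj x s

theorem IsLink.reverse {p q r s : V} (h : G.IsLink D v p q r s) : G.IsLink D v s r q p :=
  ⟨h.hs, h.hp, h.ne.symm, h.rs.symm, h.qr.symm, h.pq.symm, h.fs, h.fr, h.fq, h.fp⟩

/-- Otherwise `adj_of_atTwo` makes `p` adjacent to `r`, which `s` already dominates. -/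
theorem IsLink.adj_imp (hP : IsInducedFree (pathGraph 6) G) (hD : G.IsEfficientDominatingSet D)
    {p q r s : V} (h : G.IsLink D v p q r s) {x : V} (hx : G.AtTwo v x) (xp : G.Adj x p)
    (xq : ¬ G.Adj x q) : G.Adj x r := by
  by_contra xr
  exact hD.not_adj h.hs h.hp h.ne.symm h.rs.symm
    (hP.adj_of_atTwo hx h.fp h.fq h.fr xp h.pq h.qr xq xr)

theorem IsLink.adj_imp' (hP : IsInducedFree (pathGraph 6) G) (hD : G.IsEfficientDominatingSet D)
    {p q r s : V} (h : G.IsLink D v p q r s) {x : V} (hx : G.AtTwo v x) (xq : G.Adj x q)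
    (xr : ¬ G.Adj x r) : G.Adj x s := by
  by_contra xs
  exact hD.not_adj h.hp h.hs h.ne h.pq
    (hP.adj_of_atTwo hx h.fq h.fr h.fs xq h.qr h.rs xr xs).symm

theorem IsLink.not_both (hD : G.IsEfficientDominatingSet D) {p q r s : V}
    (h : G.IsLink D v p q r s) {x : V} (xp : G.Adj x p) : ¬ G.Adj x s :=
  fun xs => hD.not_adj h.hp h.hs h.ne xp.symm xs.symm

/-- A vertex at distance two from `v` that touches a link contains the second or the third vertex
of the link in its neighbourhood. -/
theorem IsLink.adj_middle (hP : IsInducedFree (pathGraph 6) G)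
    (hD : G.IsEfficientDominatingSet D) {p q r s : V} (h : G.IsLink D v p q r s) {x : V}
    (hx : G.AtTwo v x) (ht : G.Touches x p q r s) : G.Adj x q ∨ G.Adj x r := by
  have h₁ := h.adj_imp hP hD hx
  have h₂ := h.reverse.adj_imp hP hD hx
  unfold Touches at ht
  tauto

/-- The neighbourhood of a vertex that touches a link dominates the link. -/
theorem IsLink.dominated (hP : IsInducedFree (pathGraph 6) G)
    (hD : G.IsEfficientDominatingSet D) {p q r s : V} (h : G.IsLink D v p q r s) {x : V}
    (hx : G.AtTwo v x) (ht : G.Touches x p q r s) {t : V} (htm : t ∈ [p, q, r, s])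
    (xt : ¬ G.Adj x t) : ∃ t' ∈ [p, q, r, s], G.Adj x t' ∧ G.Adj t' t := by
  have h₃ := h.adj_imp' hP hD hx
  have h₄ := h.reverse.adj_imp' hP hD hx
  have hm := h.adj_middle hP hD hx ht
  simp only [List.mem_cons, List.not_mem_nil, or_false] at htm
  rcases htm with rfl | rfl | rfl | rfl
  · exact ⟨q, by simp, by_contra fun k => xt (h₄ (hm.resolve_left k) k), h.pq.symm⟩
  · exact ⟨r, by simp, hm.resolve_left xt, h.qr.symm⟩
  · exact ⟨q, by simp, hm.resolve_right xt, h.qr⟩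
  · exact ⟨r, by simp, by_contra fun k => xt (h₃ (hm.resolve_right k) k), h.rs⟩

/-- A vertex that touches a link splits one of its edges. -/
theorem IsLink.exists_split (hP : IsInducedFree (pathGraph 6) G)
    (hD : G.IsEfficientDominatingSet D) {p q r s : V} (h : G.IsLink D v p q r s) {x : V}
    (hx : G.AtTwo v x) (ht : G.Touches x p q r s) :
    ∃ t ∈ [p, q, r, s], ∃ t' ∈ [p, q, r, s], G.Adj x t ∧ ¬ G.Adj x t' ∧ G.Adj t t' := by
  have h₅ := h.not_both hD (x := x)
  by_cases xp : G.Adj x p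
  · obtain ⟨t', h₁, h₂, h₃⟩ := h.dominated hP hD hx ht (t := s) (by simp) (h₅ xp)
    exact ⟨t', h₁, s, by simp, h₂, h₅ xp, h₃⟩
  · obtain ⟨t', h₁, h₂, h₃⟩ := h.dominated hP hD hx ht (t := p) (by simp) xp
    exact ⟨t', h₁, p, by simp, h₂, xp, h₃⟩

theorem IsLink.far {p q r s : V} (h : G.IsLink D v p q r s) {t : V} (ht : t ∈ [p, q, r, s]) :
    ¬ G.Near2 v t := by
  simp only [List.mem_cons, List.not_mem_nil, or_false] at ht
  rcases ht with rfl | rfl | rfl | rfl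
  exacts [h.fp, h.fq, h.fr, h.fs]

theorem Touches.of_mem {x p q r s t : V} (ht : t ∈ [p, q, r, s]) (h : G.Adj x t) :
    G.Touches x p q r s := by
  simp only [List.mem_cons, List.not_mem_nil, or_false] at ht
  unfold Touches
  rcases ht with rfl | rfl | rfl | rfl <;> simp [h]

/-- No neighbour far from `v` of a vertex that does not touch a link is adjacent to the link. -/
theorem IsLink.not_adj_of_not_touches (hP : IsInducedFree (pathGraph 6) G)
    (hD : G.IsEfficientDominatingSet D) {p q r s : V} (h : G.IsLink D v p q r s) {x y : V}
    (hx : G.AtTwo v x) (ht : ¬ G.Touches x p q r s) (hy : ¬ G.Near2 v y) (xy : G.Adj x y) {t : V}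
    (htm : t ∈ [p, q, r, s]) : ¬ G.Adj y t := by
  have hn := h.not_both hD (x := y)
  unfold Touches at ht
  push Not at ht
  obtain ⟨xp, xq, xr, xs⟩ := ht
  -- Adjacency of `y` to one vertex of the link spreads along the link to both ends, but `y` cannot
  -- have two neighbours in `D`.
  have k {b c : V} (hb : ¬ G.Near2 v b) (hc : ¬ G.Near2 v c) (bc : G.Adj b c) (xb : ¬ G.Adj x b)
      (xc : ¬ G.Adj x c) (yb : G.Adj y b) : G.Adj y c :=
    hP.adj_of_atTwo hx hy hb hc xy yb bc xb xc
  have k₁ := k h.fp h.fq h.pq xp xq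
  have k₂ := k h.fq h.fr h.qr xq xr
  have k₃ := k h.fr h.fs h.rs xr xs
  have k₄ := k h.fq h.fp h.pq.symm xq xp
  have k₅ := k h.fr h.fq h.qr.symm xr xq
  have k₆ := k h.fs h.fr h.rs.symm xs xr
  simp only [List.mem_cons, List.not_mem_nil, or_false] at htm
  rcases htm with rfl | rfl | rfl | rfl <;> tauto

/-- On a walk of length at most four from `v` to `p`, the last vertex before the link has distance
two from `v`, or it is preceded by a vertex at distance two; `not_adj_of_not_touches` then shows
that this vertex touches the link. -/
theorem IsLink.exists_touches (hP : IsInducedFree (pathGraph 6) G)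
    (hD : G.IsEfficientDominatingSet D) {p q r s : V} (h : G.IsLink D v p q r s)
    (hp : G.Near4 v p) : ∃ x, G.AtTwo v x ∧ G.Touches x p q r s := by
  by_contra! hn
  obtain ⟨x, hx, y, xy, yp⟩ := hp
  have at2 {y t : V} (hy : G.Near2 v y) (yt : G.Dom y t) (ht : ¬ G.Near2 v t) : G.AtTwo v y :=
    ⟨hy, fun k => ht ⟨y, k, yt⟩⟩
  have adj {y t : V} (hy : G.Near2 v y) (yt : G.Dom y t) (ht : ¬ G.Near2 v t) : G.Adj y t := by
    rcases yt with rfl | yt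
    · exact absurd hy ht
    · exact yt
  by_cases hy : G.Near2 v y
  · exact hn y (at2 hy yp h.fp) (.inl (adj hy yp h.fp))
  · have hx' := at2 hx xy hy
    have xy' := adj hx xy hy
    rcases yp with rfl | yp
    · exact hn x hx' (.inl xy')
    · exact h.not_adj_of_not_touches hP hD hx' (hn x hx') hy xy' (by simp) yp

/-- The links touched by vertices at distance two from `v` form a chain. -/
theorem IsLink.touches_chain (hP : IsInducedFree (pathGraph 6) G)
    (hD : G.IsEfficientDominatingSet D) {p q r s p' q' r' s' : V} (h : G.IsLink D v p q r s)
    (h' : G.IsLink D v p' q' r' s') {x y : V} (hx : G.AtTwo v x) (hy : G.AtTwo v y)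
    (xt : G.Touches x p q r s) (xn : ¬ G.Touches x p' q' r' s') (yt : G.Touches y p' q' r' s') :
    G.Touches y p q r s := by
  by_contra yn
  have xa {t : V} (ht : t ∈ [p', q', r', s']) : ¬ G.Adj x t := fun k => xn (.of_mem ht k)
  have ya {t : V} (ht : t ∈ [p, q, r, s]) : ¬ G.Adj y t := fun k => yn (.of_mem ht k)
  -- No edge joins the two links. For neighbours of `x` this is `not_adj_of_not_touches`; any other
  -- vertex of the first link has a neighbour there that is adjacent to `x`, to which `adj_of_atTwo`
  -- transfers the edge.
  have sep {t t' : V} (ht : t ∈ [p, q, r, s]) (ht' : t' ∈ [p', q', r', s']) : ¬ G.Adj t t' := by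
    intro k
    by_cases xt' : G.Adj x t
    · exact h'.not_adj_of_not_touches hP hD hx xn (h.far ht) xt' ht' k
    · obtain ⟨u, hu, xu, ut⟩ := h.dominated hP hD hx xt ht xt'
      exact h'.not_adj_of_not_touches hP hD hx xn (h.far hu) xu ht'
        (hP.adj_of_atTwo hx (h.far hu) (h.far ht) (h'.far ht') xu ut k xt' (xa ht'))
  obtain ⟨b, hb, c, hc, xb, xc, bc⟩ := h.exists_split hP hD hx xt
  obtain ⟨e, he, f, hf, ye, yf, ef⟩ := h'.exists_split hP hD hy yt
  by_cases xy : G.Adj x y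
  · exact hP.not_inducedPathSix bc.symm xb.symm xy ye ef (fun k => xc k.symm)
      (fun k => ya hc k.symm) (sep hc he) (sep hc hf) (fun k => ya hb k.symm) (sep hb he)
      (sep hb hf) (xa he) (xa hf) yf
  · exact hP.not_private_pair hx hy (h.far hb) (h'.far he) (h'.far hf) xy xb ye ef
      (fun k => ya hb k.symm) (xa he) (sep hb he) (sep hb hf) (xa hf) yf

/-- Some vertex of `D` has a neighbour set that touches all links. -/
theorem exists_forall_link_touches [Finite V] (hP : IsInducedFree (pathGraph 6) G)
    (hD : G.IsEfficientDominatingSet D) (hv : v ∈ D) :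
    ∃ e ∈ D, G.Near4 v e ∧ ∀ p q r s, G.IsLink D v p q r s → G.Near4 v p →
      ∃ x, G.AtTwo v x ∧ G.Dom e x ∧ G.Touches x p q r s := by
  classical
  have := Fintype.ofFinite V
  by_cases hne : ∃ x, G.AtTwo v x
  · let T : V → Finset (V × V × V × V) := fun x => Finset.univ.filter fun l =>
      G.IsLink D v l.1 l.2.1 l.2.2.1 l.2.2.2 ∧ G.Touches x l.1 l.2.1 l.2.2.1 l.2.2.2
    obtain ⟨m, hm, hmax⟩ := (Finset.univ.filter (G.AtTwo v)).exists_max_image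
      (fun x => (T x).card) (by obtain ⟨x, hx⟩ := hne; exact ⟨x, by simpa using hx⟩)
    simp only [Finset.mem_filter, Finset.mem_univ, true_and] at hm hmax
    obtain ⟨e, he, hem⟩ := hD.exists_dom m
    refine ⟨e, he, hm.1.near4.trans_dom hP hem.symm, fun p q r s h hp => ⟨m, hm, hem, ?_⟩⟩
    -- By the chain property, a vertex touching a link missed by `m` would touch every link that `m`
    -- touches and one more.
    by_contra hn
    obtain ⟨x, hx, hxt⟩ := h.exists_touches hP hD hp
    refine absurd (hmax x hx) (not_le.mpr (Finset.card_lt_card ?_))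
    rw [Finset.ssubset_iff_of_subset]
    · exact ⟨(p, q, r, s), by simp [T, h, hxt], by simp [T, hn]⟩
    · intro l hl
      simp only [T, Finset.mem_filter, Finset.mem_univ, true_and] at hl ⊢
      exact ⟨hl.1, hl.1.touches_chain hP hD h hm hx hl.2 hn hxt⟩
  · exact ⟨v, hv, .refl v, fun p q r s h hp =>
      absurd ((h.exists_touches hP hD hp).imp fun _ => And.left) hne⟩

end SimpleGraph

/-! ### Guesses and the independent choices they leave -/

namespace SimpleGraph

variable {V : Type*} {G : SimpleGraph V} {D : Set V} {u v d e : V}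

/-- The vertex `y` is dominated by `v`, `d` or `e`. -/
def Hit (G : SimpleGraph V) (v d e y : V) : Prop := G.Dom v y ∨ G.Dom d y ∨ G.Dom e y

/-- The vertices near `u` that may join `v`, `d` and `e` in an efficient dominating set. -/
def Avail (G : SimpleGraph V) (u v d e a : V) : Prop :=
  G.Near4 u a ∧ ¬ G.Near2 v a ∧ ¬ G.Near2 d a ∧ ¬ G.Near2 e a

/-- The two vertices are dominated by a common free vertex. -/
def Mate (G : SimpleGraph V) (u v d e a b : V) : Prop :=
  ∃ c, G.Avail u v d e c ∧ G.Dom a c ∧ G.Dom c b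

/-- All free mates of `c` dominate `y`. -/
def Covers (G : SimpleGraph V) (u v d e c y : V) : Prop :=
  ∀ k, G.Avail u v d e k → G.Mate u v d e c k → G.Dom k y

/-- Some free mate of `c` dominates `y`. -/
def Meets (G : SimpleGraph V) (u v d e c y : V) : Prop :=
  ∃ k, G.Avail u v d e k ∧ G.Mate u v d e c k ∧ G.Dom k y

/-- Some free vertex covers `y`. -/
def Covered (G : SimpleGraph V) (u v d e y : V) : Prop :=
  ∃ c, G.Avail u v d e c ∧ G.Covers u v d e c y

/-- The vertex `c` is a candidate for the choice among its mates. -/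
def Good (G : SimpleGraph V) (ω : V → ℕ) (u v d e c : V) : Prop :=
  G.Avail u v d e c ∧ ω c ≠ 0 ∧ ∀ y, G.Near4 u y → ¬ G.Hit v d e y → G.Meets u v d e c y →
    (G.Covered u v d e y → G.Dom c y → G.Covers u v d e c y) ∧
    (¬ G.Covered u v d e y → G.Dom c y)

/-- The vertex `c` is the first of the lightest candidates among its mates. -/
def Sel [LinearOrder V] (G : SimpleGraph V) (ω : V → ℕ) (u v d e c : V) : Prop :=
  G.Good ω u v d e c ∧ ∀ c', G.Good ω u v d e c' → G.Mate u v d e c c' →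
    ω c < ω c' ∨ ω c = ω c' ∧ c ≤ c'

/-- The vertex set built from the guess `v`, `d`, `e`. -/
def Sol [LinearOrder V] (G : SimpleGraph V) (ω : V → ℕ) (u v d e x : V) : Prop :=
  x = v ∨ x = d ∨ x = e ∨ G.Sel ω u v d e x

/-- The guess `v`, `d`, `e` leads to an efficient dominating set of the component of `u`. -/
def Valid [LinearOrder V] (G : SimpleGraph V) (ω : V → ℕ) (u v d e : V) : Prop :=
  (G.Near4 u v ∧ G.Near4 u d ∧ G.Near4 u e) ∧ (ω v ≠ 0 ∧ ω d ≠ 0 ∧ ω e ≠ 0) ∧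
    ∀ y, G.Near4 u y → ∃ x, G.Sol ω u v d e x ∧ G.Dom x y ∧
      ∀ x', G.Sol ω u v d e x' → G.Dom x' y → x = x'

open Classical in
/-- The weight of the vertex set built from a guess. -/
noncomputable def cost [LinearOrder V] [Fintype V] (G : SimpleGraph V) (ω : V → ℕ)
    (u v d e : V) : ℕ :=
  ∑ x, if G.Sol ω u v d e x then ω x - 1 else 0

/-- A guess for the efficient dominating set `D` that determines the rest of `D` up to independent
choices. -/
structure IsGuide (G : SimpleGraph V) (D : Set V) (u v d e : V) : Prop where
  hv : v ∈ D
  hd : d ∈ D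
  he : e ∈ D
  nv : G.Near4 u v
  nd : G.Near4 u d
  ne : G.Near4 u e
  same : ∀ {a b p : V}, G.Avail u v d e a → G.Avail u v d e b → p ∈ D → G.Dom p a → G.Adj a b →
    G.Dom p b
  resolved : ∀ {y p : V}, G.Near4 u y → ¬ G.Hit v d e y → p ∈ D → G.Dom p y →
    (∀ k, G.Avail u v d e k → G.Dom p k → G.Dom k y) ∨
    (∀ k, G.Avail u v d e k → G.Dom k y → G.Dom p k)

theorem IsEfficientDominatingSet.exists_isGuide [Finite V]
    (hP : IsInducedFree (pathGraph 6) G) (hD : G.IsEfficientDominatingSet D) (u : V) :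
    ∃ v d e, G.IsGuide D u v d e := by
  obtain ⟨v, hv, vu⟩ := hD.exists_dom u
  obtain ⟨d, hd, vd, hsh⟩ := exists_forall_shadows hP hD hv
  obtain ⟨e, he, ve, hlink⟩ := exists_forall_link_touches hP hD hv
  have uv : G.Near4 u v := vu.symm.near2.near4
  have vu' : G.Near4 v u := uv.symm
  have ne {p a : V} (h : ¬ G.Near2 v a) (hpa : G.Dom p a) : v ≠ p := by
    rintro rfl
    exact h hpa.near2
  refine ⟨v, d, e, hv, hd, he, uv, uv.trans hP vd, uv.trans hP ve, ?_, ?_⟩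
  · intro a b p ha hb hp hpa hab
    by_contra hpb
    obtain ⟨q, hq, hqb⟩ := hD.exists_dom b
    have hpq : p ≠ q := by
      rintro rfl
      exact hpb hqb
    have hpa' : G.Adj p a := hpa.resolve_left fun h => hpb (h ▸ hab.dom)
    have hqb' : G.Adj q b := hqb.resolve_left fun h =>
      hpq (hD.eq_of_dom hp hq hpa (h ▸ hab.symm.dom))
    -- Different dominators would create a link with middle `a, b`. It is touched there by a vertex
    -- that `e` dominates, so `a` or `b` would be within distance two of `e` and not free.
    have hl : G.IsLink D v p a b q := ⟨hp, hq, hpq, hpa', hab, hqb'.symm,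
      hD.not_near2 hv hp (ne ha.2.1 hpa), ha.2.1, hb.2.1, hD.not_near2 hv hq (ne hb.2.1 hqb)⟩
    obtain ⟨x, hx, ex, ht⟩ := hlink p a b q hl ((vu'.trans hP ha.1).trans_dom hP hpa.symm)
    rcases hl.adj_middle hP hD hx ht with h | h
    · exact ha.2.2.2 ⟨x, ex, h.dom⟩
    · exact hb.2.2.2 ⟨x, ex, h.dom⟩
  · intro y p hy hhit hp hpy
    unfold Hit at hhit
    push Not at hhit
    obtain ⟨h₁, h₂, h₃⟩ := hhit
    have hvp : v ≠ p := fun h => h₁ (h ▸ hpy)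
    have hvp' := hD.not_near2 hv hp hvp
    have hpn : G.Near4 v p := (vu'.trans hP hy).trans_dom hP hpy.symm
    by_cases hvy : G.Near2 v y
    -- Here `y` has distance exactly two from `v`. As `d` shadows `p`, a neighbour `k` of `p` is
    -- adjacent to `y` or within distance two of `d`; the latter is excluded for free `k`.
    · refine .inl fun k hk hpk => ?_
      have hpy' : G.Adj p y := hpy.resolve_left fun h => hvp' (h ▸ hvy)
      rcases hpk with rfl | hpk
      · exact hpy
      · have hpd : p ≠ d := fun h => h₂ (h ▸ hpy)
        rcases (hsh p hp hpn).resolve_left hpd y ⟨hvy, h₁⟩ hpy'.symm k hk.2.1 hpk with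
          h | ⟨z, -, hzd, hzk⟩
        · exact h.symm.dom
        · exact absurd ⟨z, hzd.symm.dom, hzk.dom⟩ hk.2.2.1
    · refine .inr fun k hk hky => ?_
      by_contra hpk
      obtain ⟨q, hq, hqk⟩ := hD.exists_dom k
      have hpq : p ≠ q := by
        rintro rfl
        exact hpk hqk
      have hky' : G.Adj k y := hky.resolve_left fun h => hpk (h ▸ hpy)
      have hpy' : G.Adj p y := hpy.resolve_left fun h => hpk (h ▸ hky'.symm.dom)
      have hqk' : G.Adj q k := hqk.resolve_left fun h =>
        hpq (hD.eq_of_dom hp hq hpy (h ▸ hky'.dom))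
      -- The vertex `x` dominated by `e` is adjacent to `y` but not to the free vertex `k`, hence
      -- also to `q`. Then `e = q`, which is too close to `k`.
      have hl : G.IsLink D v p y k q := ⟨hp, hq, hpq, hpy', hky'.symm, hqk'.symm, hvp', hvy,
        hk.2.1, hD.not_near2 hv hq (ne hk.2.1 hqk)⟩
      obtain ⟨x, hx, ex, ht⟩ := hlink p y k q hl hpn
      have xk : ¬ G.Adj x k := fun h => hk.2.2.2 ⟨x, ex, h.dom⟩
      have xy := (hl.adj_middle hP hD hx ht).resolve_right xk
      have xq := hl.adj_imp' hP hD hx xy xk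
      have eq : e = q := by_contra fun h => hD.not_near2 he hq h ⟨x, ex, xq.dom⟩
      exact hk.2.2.2 (eq ▸ hqk.near2)

section Guide

variable (hP : IsInducedFree (pathGraph 6) G) (hD : G.IsEfficientDominatingSet D)
  (hg : G.IsGuide D u v d e)

include hD hg in
theorem IsGuide.avail {p : V} (hp : p ∈ D) (hup : G.Near4 u p) (hv : p ≠ v) (hd : p ≠ d)
    (he : p ≠ e) : G.Avail u v d e p :=
  ⟨hup, hD.not_near2 hg.hv hp hv.symm, hD.not_near2 hg.hd hp hd.symm,
    hD.not_near2 hg.he hp he.symm⟩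

theorem Avail.ne_of_dom {a p : V} (ha : G.Avail u v d e a) (h : G.Dom p a) :
    p ≠ v ∧ p ≠ d ∧ p ≠ e := by
  obtain ⟨-, h₁, h₂, h₃⟩ := ha
  refine ⟨?_, ?_, ?_⟩ <;> rintro rfl
  exacts [h₁ h.near2, h₂ h.near2, h₃ h.near2]

include hP hD hg in
theorem IsGuide.avail_of_dom {a p : V} (ha : G.Avail u v d e a) (hp : p ∈ D) (h : G.Dom p a) :
    G.Avail u v d e p := by
  obtain ⟨h₁, h₂, h₃⟩ := ha.ne_of_dom h
  exact hg.avail hD hp (ha.1.trans_dom hP h.symm) h₁ h₂ h₃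

-- By `same`, the dominator in `D` is constant along edges between free vertices. So the classes cut
-- out by `D` are the classes of mates, which are defined without `D`.
include hP hD hg in
theorem IsGuide.mate_iff {a b p : V} (ha : G.Avail u v d e a) (hb : G.Avail u v d e b)
    (hp : p ∈ D) (h : G.Dom p a) : G.Mate u v d e a b ↔ G.Dom p b := by
  constructor
  · rintro ⟨c, hc, hac, hcb⟩
    have hpc : G.Dom p c := by
      rcases hac with rfl | hac
      · exact h
      · exact hg.same ha hc hp h hac
    rcases hcb with rfl | hcb
    · exact hpc
    · exact hg.same hc hb hp hpc hcb
  · exact fun h' => ⟨p, hg.avail_of_dom hP hD ha hp h, h.symm, h'⟩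

include hP hD hg in
theorem IsGuide.dom_of_covers {c p y : V} (hc : G.Avail u v d e c)
    (h : G.Covers u v d e c y) (hp : p ∈ D) (hpc : G.Dom p c) : G.Dom p y :=
  h p (hg.avail_of_dom hP hD hc hp hpc)
    ((hg.mate_iff hP hD hc (hg.avail_of_dom hP hD hc hp hpc) hp hpc).2 (.refl p))

include hP hD hg in
/-- If a vertex is not covered, then all free vertices dominating it are mates. -/
theorem IsGuide.dom_of_not_covered {y p k : V} (hy : G.Near4 u y) (hhit : ¬ G.Hit v d e y)
    (hn : ¬ G.Covered u v d e y) (hp : p ∈ D) (hpy : G.Dom p y) (hk : G.Avail u v d e k)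
    (hky : G.Dom k y) : G.Dom p k := by
  unfold Hit at hhit
  push Not at hhit
  obtain ⟨h₁, h₂, h₃⟩ := hhit
  have hpa : G.Avail u v d e p := hg.avail hD hp (hy.trans_dom hP hpy.symm)
    (fun h => h₁ (h ▸ hpy)) (fun h => h₂ (h ▸ hpy)) (fun h => h₃ (h ▸ hpy))
  rcases hg.resolved hy (by unfold Hit; tauto) hp hpy with h | h
  · exact absurd ⟨p, hpa, fun k hk hm => h k hk
      ((hg.mate_iff hP hD hpa hk hp (.refl p)).1 hm)⟩ hn
  · exact h k hk hky

-- The test in `Good` is passed by `D` itself. A covered `y` is dominated by the vertex of `D` in a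
-- covering class, so if `p` dominates `y`, then its own class is that one. For an uncovered `y`
-- that the class of `p` meets, the dominator of `y` lies in this class and hence is `p`.
include hP hD hg in
theorem IsGuide.good {ω : V → ℕ} {p : V} (hp : p ∈ D) (hpa : G.Avail u v d e p)
    (hω : ω p ≠ 0) : G.Good ω u v d e p := by
  refine ⟨hpa, hω, fun y hy hhit ⟨k, hk, hpk, hky⟩ => ⟨?_, ?_⟩⟩
  · rintro ⟨c, hc, hcov⟩ hpy
    obtain ⟨q, hq, hqc⟩ := hD.exists_dom c
    have hqy := hg.dom_of_covers hP hD hc hcov hq hqc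
    obtain rfl := hD.eq_of_dom hq hp hqy hpy
    exact fun k hk hm => hcov k hk ((hg.mate_iff hP hD hc hk hq hqc).2
      ((hg.mate_iff hP hD hpa hk hq (.refl q)).1 hm))
  · intro hn
    obtain ⟨q, hq, hqy⟩ := hD.exists_dom y
    have hqk := hg.dom_of_not_covered hP hD hy hhit hn hq hqy hk hky
    have hpk' := (hg.mate_iff hP hD hpa hk hp (.refl p)).1 hpk
    rwa [hD.eq_of_dom hp hq hpk' hqk]

variable [LinearOrder V] {ω : V → ℕ}

include hP hD hg in
theorem IsGuide.sel_unique {c c' p : V} (hp : p ∈ D) (hc : G.Sel ω u v d e c)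
    (hc' : G.Sel ω u v d e c') (h : G.Dom p c) (h' : G.Dom p c') : c = c' := by
  have h₁ := hc.2 c' hc'.1 ((hg.mate_iff hP hD hc.1.1 hc'.1.1 hp h).2 h')
  have h₂ := hc'.2 c hc.1 ((hg.mate_iff hP hD hc'.1.1 hc.1.1 hp h').2 h)
  refine le_antisymm ?_ ?_
  · rcases h₁ with h₁ | h₁
    · rcases h₂ with h₂ | h₂ <;> omega
    · exact h₁.2
  · rcases h₂ with h₂ | h₂
    · rcases h₁ with h₁ | h₁ <;> omega
    · exact h₂.2

include hP hD hg in
theorem IsGuide.exists_sel [Finite V] {p : V} (hp : p ∈ D) (hpa : G.Avail u v d e p)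
    (hω : ω p ≠ 0) : ∃ c, G.Sel ω u v d e c ∧ G.Dom p c := by
  classical
  have := Fintype.ofFinite V
  obtain ⟨c, hc, hmin⟩ := (Finset.univ.filter fun c => G.Good ω u v d e c ∧
    G.Dom p c).exists_min_image (fun c => toLex (ω c, c))
    ⟨p, by simpa using ⟨hg.good hP hD hp hpa hω, .refl p⟩⟩
  simp only [Finset.mem_filter, Finset.mem_univ, true_and] at hc hmin
  refine ⟨c, ⟨hc.1, fun c' hc' hm => ?_⟩, hc.2⟩
  exact (Prod.Lex.le_iff).1 (hmin c' ⟨hc', (hg.mate_iff hP hD hc.1.1 hc'.1 hp hc.2).1 hm⟩)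

-- Selected vertices are too far from the guess to dominate anything it hits. A covered `y` is
-- covered by exactly one class, whose selected vertex dominates it, and goodness keeps the other
-- classes away. The free dominators of an uncovered `y` lie in one class, and goodness makes the
-- selected vertex of that class dominate `y`.
include hP hD hg in
theorem IsGuide.valid [Finite V] (hω : ∀ p ∈ D, ω p ≠ 0) : G.Valid ω u v d e := by
  refine ⟨⟨hg.nv, hg.nd, hg.ne⟩, ⟨hω v hg.hv, hω d hg.hd, hω e hg.he⟩, fun y hy => ?_⟩
  have hsol {q : V} (hq : q = v ∨ q = d ∨ q = e) : G.Sol ω u v d e q := by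
    unfold Sol
    tauto
  have hmem {q : V} (hq : q = v ∨ q = d ∨ q = e) : q ∈ D := by
    rcases hq with rfl | rfl | rfl
    exacts [hg.hv, hg.hd, hg.he]
  by_cases hhit : G.Hit v d e y
  · obtain ⟨q, hq, hqy⟩ : ∃ q, (q = v ∨ q = d ∨ q = e) ∧ G.Dom q y := by
      rcases hhit with h | h | h
      exacts [⟨v, by simp, h⟩, ⟨d, by simp, h⟩, ⟨e, by simp, h⟩]
    refine ⟨q, hsol hq, hqy, fun x hx hxy => ?_⟩
    by_cases hx' : x = v ∨ x = d ∨ x = e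
    · exact hD.eq_of_dom (hmem hq) (hmem hx') hqy hxy
    · obtain ⟨-, h₁, h₂, h₃⟩ : G.Avail u v d e x := by
        unfold Sol at hx
        have : G.Sel ω u v d e x := by tauto
        exact this.1.1
      have : G.Near2 q x := ⟨y, hqy, hxy.symm⟩
      rcases hq with rfl | rfl | rfl <;> contradiction
  · have hsel {x : V} (hx : G.Sol ω u v d e x) (hxy : G.Dom x y) : G.Sel ω u v d e x := by
      unfold Hit at hhit
      rcases hx with rfl | rfl | rfl | hx
      · exact absurd (.inl hxy) hhit
      · exact absurd (.inr (.inl hxy)) hhit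
      · exact absurd (.inr (.inr hxy)) hhit
      · exact hx
    by_cases hcov : G.Covered u v d e y
    · obtain ⟨k, hk, hky⟩ := id hcov
      obtain ⟨p, hp, hpk⟩ := hD.exists_dom k
      have hpa := hg.avail_of_dom hP hD hk hp hpk
      obtain ⟨c, hc, hpc⟩ := hg.exists_sel hP hD hp hpa (hω p hp)
      refine ⟨c, .inr (.inr (.inr hc)),
        hky c hc.1.1 ((hg.mate_iff hP hD hk hc.1.1 hp hpk).2 hpc), fun x hx hxy => ?_⟩
      have hx' := hsel hx hxy
      obtain ⟨q, hq, hqx⟩ := hD.exists_dom x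
      have hcx := (hx'.1.2.2 y hy hhit ⟨x, hx'.1.1, (hg.mate_iff hP hD hx'.1.1 hx'.1.1 hq
        hqx).2 hqx, hxy⟩).1 hcov hxy
      obtain rfl := hD.eq_of_dom hp hq (hg.dom_of_covers hP hD hk hky hp hpk)
        (hg.dom_of_covers hP hD hx'.1.1 hcx hq hqx)
      exact hg.sel_unique hP hD hp hc hx' hpc hqx
    · obtain ⟨p, hp, hpy⟩ := hD.exists_dom y
      have hpa : G.Avail u v d e p := by
        unfold Hit at hhit
        push Not at hhit
        obtain ⟨h₁, h₂, h₃⟩ := hhit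
        exact hg.avail hD hp (hy.trans_dom hP hpy.symm)
          (fun h => h₁ (h ▸ hpy)) (fun h => h₂ (h ▸ hpy)) (fun h => h₃ (h ▸ hpy))
      obtain ⟨c, hc, hpc⟩ := hg.exists_sel hP hD hp hpa (hω p hp)
      refine ⟨c, .inr (.inr (.inr hc)), (hc.1.2.2 y hy hhit ⟨p, hpa,
        (hg.mate_iff hP hD hc.1.1 hpa hp hpc).2 (.refl p), hpy⟩).2 hcov, fun x hx hxy => ?_⟩
      have hx' := hsel hx hxy
      exact hg.sel_unique hP hD hp hc hx' hpc
        (hg.dom_of_not_covered hP hD hy hhit hcov hp hpy hx'.1.1 hxy)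

include hP hD hg in
theorem IsGuide.sol_eq {x x' p : V} (hp : p ∈ D) (hx : G.Sol ω u v d e x)
    (hx' : G.Sol ω u v d e x') (h : G.Dom p x) (h' : G.Dom p x') : x = x' := by
  have key {x : V} (hx : G.Sol ω u v d e x) (h : G.Dom p x) :
      (x = p ∧ (p = v ∨ p = d ∨ p = e)) ∨ (G.Sel ω u v d e x ∧ ¬ (p = v ∨ p = d ∨ p = e)) := by
    rcases hx with rfl | rfl | rfl | hx
    · exact .inl ⟨hD.eq_of_dom hg.hv hp (.refl _) h, .inl (hD.eq_of_dom hp hg.hv h (.refl _))⟩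
    · exact .inl ⟨hD.eq_of_dom hg.hd hp (.refl _) h,
        .inr (.inl (hD.eq_of_dom hp hg.hd h (.refl _)))⟩
    · exact .inl ⟨hD.eq_of_dom hg.he hp (.refl _) h,
        .inr (.inr (hD.eq_of_dom hp hg.he h (.refl _)))⟩
    · have := hx.1.1.ne_of_dom h
      exact .inr ⟨hx, by tauto⟩
  rcases key hx h with ⟨h₁, h₂⟩ | ⟨h₁, h₂⟩ <;> rcases key hx' h' with ⟨h₃, h₄⟩ | ⟨h₃, h₄⟩
  · exact h₁.trans h₃.symm
  · exact absurd h₂ h₄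
  · exact absurd h₄ h₂
  · exact hg.sel_unique hP hD hp h₁ h₃ h h'

-- Sending each vertex of the built set to its dominator in `D` is injective (`sol_eq`) and never
-- decreases the weight, since that dominator was a competitor in the selection.
open Classical in
include hP hD hg in
theorem IsGuide.cost_le [Fintype V] (hω : ∀ p ∈ D, ω p ≠ 0) :
    G.cost ω u v d e ≤ ∑ x, if x ∈ D ∧ G.Near4 u x then ω x - 1 else 0 := by
  choose δ hδ hδ' using hD.exists_dom
  have hle {x : V} (hx : G.Sol ω u v d e x) : ω x ≤ ω (δ x) := by
    rcases hx with rfl | rfl | rfl | hx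
    · rw [hD.eq_of_dom (hδ x) hg.hv (hδ' x) (.refl x)]
    · rw [hD.eq_of_dom (hδ x) hg.hd (hδ' x) (.refl x)]
    · rw [hD.eq_of_dom (hδ x) hg.he (hδ' x) (.refl x)]
    · have ha := hg.avail_of_dom hP hD hx.1.1 (hδ x) (hδ' x)
      rcases hx.2 (δ x) (hg.good hP hD (hδ x) ha (hω _ (hδ x)))
        ((hg.mate_iff hP hD hx.1.1 ha (hδ x) (hδ' x)).2 (.refl _)) with h | h
      · exact h.le
      · exact h.1.le
  have hnear {x : V} (hx : G.Sol ω u v d e x) : G.Near4 u x := by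
    rcases hx with rfl | rfl | rfl | hx
    exacts [hg.nv, hg.nd, hg.ne, hx.1.1.1]
  unfold cost
  rw [← Finset.sum_filter, ← Finset.sum_filter]
  calc _ ≤ ∑ x with G.Sol ω u v d e x, (ω (δ x) - 1) := Finset.sum_le_sum fun x hx =>
        Nat.sub_le_sub_right (hle (Finset.mem_filter.1 hx).2) 1
    _ = ∑ y ∈ Finset.image δ {x | G.Sol ω u v d e x}, (ω y - 1) := by
        refine (Finset.sum_image (f := fun y => ω y - 1) fun x hx x' hx' h => ?_).symm
        exact hg.sol_eq hP hD (hδ x) (Finset.mem_filter.1 hx).2 (Finset.mem_filter.1 hx').2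
          (hδ' x) (h ▸ hδ' x')
    _ ≤ _ := by
        refine Finset.sum_le_sum_of_subset fun y hy => ?_
        obtain ⟨x, hx, rfl⟩ := Finset.mem_image.1 hy
        simpa using ⟨hδ x, (hnear (Finset.mem_filter.1 hx).2).trans_dom hP (hδ' x).symm⟩

end Guide

end SimpleGraph

/-! ### The best guess in each component and the optimum -/

namespace SimpleGraph

variable {V : Type*} [LinearOrder V] {G : SimpleGraph V} {D : Set V} {u v d e : V} {ω : V → ℕ}

/-- The first of the valid guesses of minimum cost. -/
def Best [Fintype V] (G : SimpleGraph V) (ω : V → ℕ) (u v d e : V) : Prop :=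
  G.Valid ω u v d e ∧ ∀ v' d' e', G.Valid ω u v' d' e' →
    G.cost ω u v d e < G.cost ω u v' d' e' ∨ G.cost ω u v d e = G.cost ω u v' d' e' ∧
      (v < v' ∨ v = v' ∧ (d < d' ∨ d = d' ∧ e ≤ e'))

/-- The vertex `u` belongs to the vertex set built from the best guess in its component. -/
def Chosen [Fintype V] (G : SimpleGraph V) (ω : V → ℕ) (u : V) : Prop :=
  ∃ v d e, G.Best ω u v d e ∧ G.Sol ω u v d e u

/-- Breaking ties lexicographically makes the best guess unique, so all vertices of a component
agree on it. -/
theorem best_iff [Fintype V] : G.Best ω u v d e ↔ G.Valid ω u v d e ∧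
    ∀ v' d' e', G.Valid ω u v' d' e' → toLex (G.cost ω u v d e, toLex (v, toLex (d, e))) ≤
      toLex (G.cost ω u v' d' e', toLex (v', toLex (d', e'))) := by
  simp only [Best, Prod.Lex.toLex_le_toLex]

theorem exists_best [Fintype V] (h : ∃ v d e, G.Valid ω u v d e) :
    ∃ v d e, G.Best ω u v d e := by
  classical
  obtain ⟨v, d, e, h⟩ := h
  obtain ⟨⟨v', d', e'⟩, hmem, hmin⟩ := (Finset.univ.filter fun g : V × V × V =>
    G.Valid ω u g.1 g.2.1 g.2.2).exists_min_image
    (fun g => toLex (G.cost ω u g.1 g.2.1 g.2.2, toLex (g.1, toLex (g.2.1, g.2.2))))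
    ⟨(v, d, e), by simpa using h⟩
  simp only [Finset.mem_filter, Finset.mem_univ, true_and, Prod.forall] at hmem hmin
  exact ⟨v', d', e', best_iff.2 ⟨hmem, hmin⟩⟩

theorem Best.eq [Fintype V] {v' d' e' : V} (h : G.Best ω u v d e) (h' : G.Best ω u v' d' e') :
    v = v' ∧ d = d' ∧ e = e' := by
  have := le_antisymm ((best_iff.1 h).2 v' d' e' h'.1) ((best_iff.1 h').2 v d e h.1)
  simpa using (Prod.mk.inj (toLex.injective this)).2

variable (hP : IsInducedFree (pathGraph 6) G)

omit [LinearOrder V] in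
include hP in
theorem Near4.congr {u u' : V} (h : G.Near4 u u') : G.Near4 u = G.Near4 u' := by
  funext y
  exact propext ⟨fun k => h.symm.trans hP k, fun k => h.trans hP k⟩

-- The vertex `u` enters the construction only through `Near4 u`, that is, through its component.
include hP in
theorem Near4.sol_congr {u u' : V} (h : G.Near4 u u') : G.Sol ω u = G.Sol ω u' := by
  have hA : G.Avail u = G.Avail u' := by
    unfold Avail
    rw [h.congr hP]
  have hM : G.Mate u = G.Mate u' := by
    unfold Mate
    rw [hA]
  unfold Sol Sel Good Meets Covered Covers
  rw [hM, hA, h.congr hP]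

include hP in
theorem Near4.best_congr [Fintype V] {u u' : V} (h : G.Near4 u u') :
    G.Best ω u = G.Best ω u' := by
  unfold Best Valid cost
  rw [h.sol_congr hP, h.congr hP]

include hP in
theorem Best.chosen_iff [Fintype V] (hb : G.Best ω u v d e) {x : V} (hx : G.Near4 u x) :
    G.Chosen ω x ↔ G.Sol ω u v d e x := by
  unfold Chosen
  rw [← hx.best_congr hP, ← hx.sol_congr hP]
  constructor
  · rintro ⟨v', d', e', hb', hs⟩
    obtain ⟨rfl, rfl, rfl⟩ := hb.eq hb'
    exact hs
  · exact fun h => ⟨v, d, e, hb, h⟩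

theorem Valid.ne_zero (h : G.Valid ω u v d e) {x : V} (hx : G.Sol ω u v d e x) : ω x ≠ 0 := by
  rcases hx with rfl | rfl | rfl | hx
  exacts [h.2.1.1, h.2.1.2.1, h.2.1.2.2, hx.1.2.1]

theorem Valid.near (h : G.Valid ω u v d e) {x : V} (hx : G.Sol ω u v d e x) : G.Near4 u x := by
  rcases hx with rfl | rfl | rfl | hx
  exacts [h.1.1, h.1.2.1, h.1.2.2, hx.1.1.1]

variable [Fintype V]

include hP in
theorem isEfficientDominatingSet_chosen (h : ∀ u, ∃ v d e, G.Valid ω u v d e) :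
    G.IsEfficientDominatingSet {x | G.Chosen ω x} := by
  intro y
  obtain ⟨v, d, e, hb⟩ := exists_best (h y)
  obtain ⟨x, hx, hxy, huniq⟩ := hb.1.2.2 y (.refl y)
  have near {x : V} (hxy : G.Dom x y) : G.Near4 y x := hxy.symm.near2.near4
  refine ⟨x, ⟨(hb.chosen_iff hP (near hxy)).2 hx, hxy⟩, fun x' ⟨hx', hx'y⟩ => ?_⟩
  exact (huniq x' ((hb.chosen_iff hP (near hx'y)).1 hx') hx'y).symm

theorem Chosen.ne_zero {x : V} (h : G.Chosen ω x) : ω x ≠ 0 := by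
  obtain ⟨v, d, e, hb, hs⟩ := h
  exact hb.1.ne_zero hs

include hP in
theorem IsEfficientDominatingSet.exists_valid (hD : G.IsEfficientDominatingSet D)
    (hω : ∀ p ∈ D, ω p ≠ 0) (u : V) : ∃ v d e, G.Valid ω u v d e := by
  obtain ⟨v, d, e, hg⟩ := hD.exists_isGuide hP u
  exact ⟨v, d, e, hg.valid hP hD hω⟩

open Classical in
include hP in
theorem sum_chosen_le (h : ∀ u, ∃ v d e, G.Valid ω u v d e)
    (hD : G.IsEfficientDominatingSet D) (hω : ∀ p ∈ D, ω p ≠ 0) :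
    (∑ x, if G.Chosen ω x then ω x - 1 else 0) ≤ ∑ x, if x ∈ D then ω x - 1 else 0 := by
  let κ : V → Finset V := fun x => {y | G.Near4 x y}
  have hκ {u x : V} : κ x = κ u ↔ G.Near4 u x := by
    constructor
    · intro k
      have : x ∈ κ x := by simpa [κ] using Near4.refl x
      simpa [k, κ] using this
    · intro k
      simp only [κ, k.congr hP]
  -- The fibres of `κ` are the components; values not attained by `κ` contribute empty sums.
  rw [← Finset.sum_fiberwise (g := κ) (s := Finset.univ),
    ← Finset.sum_fiberwise (g := κ) (s := Finset.univ) (f := fun x => if x ∈ D then ω x - 1 else 0)]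
  refine Finset.sum_le_sum fun j _ => ?_
  by_cases hj : ∃ u, κ u = j
  · obtain ⟨u, rfl⟩ := hj
    obtain ⟨v, d, e, hb⟩ := exists_best (h u)
    obtain ⟨v', d', e', hg⟩ := hD.exists_isGuide hP u
    calc (∑ x with κ x = κ u, if G.Chosen ω x then ω x - 1 else 0) = G.cost ω u v d e := by
          rw [Finset.sum_filter, cost]
          refine Finset.sum_congr rfl fun x _ => ?_
          simp only [hκ]
          by_cases hx : G.Near4 u x
          · simp only [hx, if_true, hb.chosen_iff hP hx]
          · rw [if_neg hx, if_neg fun k => hx (hb.1.near k)]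
      _ ≤ G.cost ω u v' d' e' := by
          rcases hb.2 v' d' e' (hg.valid hP hD hω) with k | k
          exacts [k.le, k.1.le]
      _ ≤ _ := hg.cost_le hP hD hω
      _ = _ := by
          rw [Finset.sum_filter]
          refine Finset.sum_congr rfl fun x _ => ?_
          by_cases hx : G.Near4 u x <;> simp [hκ, hx]
  · rw [Finset.sum_filter, Finset.sum_eq_zero]
    · exact Nat.zero_le _
    · exact fun x _ => if_neg fun k => hj ⟨x, k⟩

end SimpleGraph

/-! ### Expressing the construction by terms -/

namespace WED

open RAM

/-- The state of the machine that holds the instance `x`. -/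
noncomputable abbrev Instance.state (x : Instance) : State := RAM.initial (encode x)

/-- The encoded weight of a vertex. -/
noncomputable def Instance.code (x : Instance) (v : Fin x.n) : ℕ := encodeWeight (x.weight v)

theorem Instance.state_one (x : Instance) : x.state 1 0 = x.n := by
  simp [Instance.state, RAM.initial, encode, memOf]

theorem Instance.state_two (x : Instance) (i j : Fin x.n) :
    x.state 2 (x.n * i + j) ≠ 0 ↔ x.graph.Adj i j := by
  have h : x.n * (i : ℕ) + j < x.n * x.n := by
    have := Nat.mul_le_mul_left x.n (Nat.succ_le_of_lt i.2)
    rw [Nat.mul_succ] at this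
    omega
  have hi : (⟨x.n * i + j, h⟩ : Fin (x.n * x.n)).divNat = i := by
    ext
    simp [Fin.divNat, Nat.mul_add_div (i.pos), Nat.div_eq_of_lt j.2]
  have hj : (⟨x.n * i + j, h⟩ : Fin (x.n * x.n)).modNat = j := by
    ext
    simp [Fin.modNat, Nat.mod_eq_of_lt j.2]
  have : x.state 2 (x.n * i + j) = (List.ofFn fun i : Fin (x.n * x.n) => open Classical in
    if x.graph.Adj i.divNat i.modNat then 1 else 0).getD (x.n * i + j) 0 := rfl
  rw [this, List.getD_eq_getElem _ _ (by simpa using h)]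
  simp [hi, hj]

theorem Instance.state_three (x : Instance) (k : ℕ) :
    x.state 3 k = if h : k < x.n then x.code ⟨k, h⟩ else 0 := by
  have : x.state 3 k = (List.ofFn fun v : Fin x.n => encodeWeight (x.weight v)).getD k 0 := rfl
  rw [this]
  split_ifs with h
  · rw [List.getD_eq_getElem _ _ (by simpa using h)]
    simp [Instance.code]
  · rw [List.getD_eq_default _ _ (by simpa using h)]

/-- A family of functions on vertices is computed by a term. -/
def FunDef {d : ℕ} (f : (x : Instance) → (Fin d → Fin x.n) → ℕ) : Prop :=
  ∃ t : Term d, ∀ x e, t.eval x.state (fun j => e j) = f x e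

/-- A family of predicates on vertices is decided by a term. -/
def PredDef {d : ℕ} (P : (x : Instance) → (Fin d → Fin x.n) → Prop) : Prop :=
  ∃ t : Term d, ∀ x e, t.eval x.state (fun j => e j) ≠ 0 ↔ P x e

section

variable {d : ℕ} {f g : (x : Instance) → (Fin d → Fin x.n) → ℕ}
  {P Q : (x : Instance) → (Fin d → Fin x.n) → Prop}

theorem FunDef.const (k : ℕ) : FunDef fun x (_ : Fin d → Fin x.n) => k :=
  ⟨.const k, fun _ _ => rfl⟩

theorem FunDef.var (j : Fin d) : FunDef fun _ e => (e j : ℕ) :=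
  ⟨.var j, fun _ _ => rfl⟩

theorem FunDef.add (hf : FunDef f) (hg : FunDef g) : FunDef fun x e => f x e + g x e := by
  obtain ⟨t, ht⟩ := hf
  obtain ⟨t', ht'⟩ := hg
  exact ⟨.add t t', fun x e => by rw [Term.eval, ht, ht']⟩

theorem FunDef.sub (hf : FunDef f) (hg : FunDef g) : FunDef fun x e => f x e - g x e := by
  obtain ⟨t, ht⟩ := hf
  obtain ⟨t', ht'⟩ := hg
  exact ⟨.sub t t', fun x e => by rw [Term.eval, ht, ht']⟩

theorem FunDef.inp (m : Fin 3) (hf : FunDef f) : FunDef fun x e => x.state (m + 1) (f x e) := by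
  obtain ⟨t, ht⟩ := hf
  exact ⟨.inp m t, fun x e => by rw [Term.eval, ht]⟩

theorem snoc_val {d n : ℕ} (e : Fin d → Fin n) (i : Fin n) :
    Fin.snoc (α := fun _ => ℕ) (fun j => (e j : ℕ)) i =
      fun j => ((Fin.snoc (α := fun _ => Fin n) e i j : Fin n) : ℕ) := by
  funext j
  refine Fin.lastCases ?_ (fun j => ?_) j <;> simp

theorem FunDef.sum {f : (x : Instance) → (Fin d → Fin x.n) → Fin x.n → ℕ}
    (hf : FunDef (d := d + 1) fun x e => f x (fun j => e j.castSucc) (e (Fin.last d))) :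
    FunDef fun x e => ∑ i, f x e i := by
  obtain ⟨t, ht⟩ := hf
  refine ⟨.sum t, fun x e => ?_⟩
  rw [Term.eval, Instance.state_one, Finset.sum_range]
  refine Finset.sum_congr rfl fun i _ => ?_
  rw [snoc_val, ht]
  simp

theorem FunDef.ne_zero (hf : FunDef f) : PredDef fun x e => f x e ≠ 0 := by
  obtain ⟨t, ht⟩ := hf
  exact ⟨t, fun x e => by rw [ht]⟩

theorem PredDef.congr (hP : PredDef P) (h : ∀ x e, P x e ↔ Q x e) : PredDef Q := by
  obtain ⟨t, ht⟩ := hP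
  exact ⟨t, fun x e => (ht x e).trans (h x e)⟩

theorem FunDef.lt (hf : FunDef f) (hg : FunDef g) : PredDef fun x e => f x e < g x e :=
  (hg.sub hf).ne_zero.congr fun x e => by rw [Nat.sub_ne_zero_iff_lt]

-- Truncated subtraction `1 - t` sends every nonzero value to `0` and zero to `1`.
open Classical in
theorem PredDef.not_indicator (hP : PredDef P) : FunDef fun x e => if P x e then 0 else 1 := by
  obtain ⟨t, ht⟩ := hP
  refine ⟨.sub (.const 1) t, fun x e => ?_⟩
  have := ht x e
  simp only [Term.eval]
  split_ifs with h
  · have := this.2 h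
    omega
  · have := not_not.1 (mt this.1 h)
    omega

theorem PredDef.not (hP : PredDef P) : PredDef fun x e => ¬ P x e :=
  hP.not_indicator.ne_zero.congr fun x e => by split_ifs with h <;> simp [h]

open Classical in
theorem PredDef.indicator (hP : PredDef P) : FunDef fun x e => if P x e then 1 else 0 := by
  obtain ⟨t, ht⟩ := hP.not.not_indicator
  exact ⟨t, fun x e => by rw [ht]; by_cases h : P x e <;> simp [h]⟩

theorem PredDef.or (hP : PredDef P) (hQ : PredDef Q) : PredDef fun x e => P x e ∨ Q x e := by
  classical
  exact (hP.indicator.add hQ.indicator).ne_zero.congr fun x e => by split_ifs <;> simp_all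

theorem PredDef.and (hP : PredDef P) (hQ : PredDef Q) : PredDef fun x e => P x e ∧ Q x e :=
  (hP.not.or hQ.not).not.congr fun x e => by tauto

theorem PredDef.imp (hP : PredDef P) (hQ : PredDef Q) : PredDef fun x e => P x e → Q x e :=
  (hP.not.or hQ).congr fun x e => by tauto

theorem PredDef.ex {P : (x : Instance) → (Fin d → Fin x.n) → Fin x.n → Prop}
    (hP : PredDef (d := d + 1) fun x e => P x (fun j => e j.castSucc) (e (Fin.last d))) :
    PredDef fun x e => ∃ i, P x e i := by
  classical
  exact (FunDef.sum (f := fun x e i => if P x e i then 1 else 0) hP.indicator).ne_zero.congr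
    fun x e => by simp

theorem PredDef.all {P : (x : Instance) → (Fin d → Fin x.n) → Fin x.n → Prop}
    (hP : PredDef (d := d + 1) fun x e => P x (fun j => e j.castSucc) (e (Fin.last d))) :
    PredDef fun x e => ∀ i, P x e i :=
  (PredDef.ex (P := fun x e i => ¬ P x e i) hP.not).not.congr fun x e => by simp

theorem FunDef.eq (hf : FunDef f) (hg : FunDef g) : PredDef fun x e => f x e = g x e :=
  ((hf.lt hg).or (hg.lt hf)).not.congr fun x e => by omega

theorem PredDef.lt (i j : Fin d) : PredDef fun _ e => e i < e j :=
  (FunDef.var i).lt (.var j)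

theorem PredDef.le (i j : Fin d) : PredDef fun _ e => e i ≤ e j :=
  (PredDef.lt j i).not.congr fun x e => by simp

theorem PredDef.eq (i j : Fin d) : PredDef fun _ e => e i = e j :=
  ((FunDef.var i).eq (.var j)).congr fun x e => by rw [Fin.ext_iff]

theorem PredDef.adj (i j : Fin d) : PredDef fun x e => x.graph.Adj (e i) (e j) :=
  -- The machine has no multiplication: the row offset `n * i` is the sum of `n` copies of `i`.
  (((FunDef.sum (f := fun x e _ => (e i : ℕ)) (.var i.castSucc)).add (.var j)).inp 1).ne_zero.congr
    fun x e => by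
      rw [← Instance.state_two]
      simp

theorem FunDef.code (i : Fin d) : FunDef fun x e => x.code (e i) := by
  obtain ⟨t, ht⟩ := (FunDef.var i).inp 2
  exact ⟨t, fun x e => by rw [ht]; simpa using x.state_three (e i)⟩

-- The product of a weight and an indicator, without multiplication: if `P` fails, the address is
-- shifted by `n`, past all weights, where memory `3` holds `0`.
open Classical in
theorem FunDef.code_of (i : Fin d)
    (hP : PredDef (d := d + 1) fun x e => P x fun j => e j.castSucc) :
    FunDef fun x e => if P x e then x.code (e i) else 0 := by
  obtain ⟨t, ht⟩ := ((FunDef.var i).add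
    (FunDef.sum (f := fun x e _ => if P x e then 0 else 1) hP.not_indicator)).inp 2
  refine ⟨t, fun x e => ?_⟩
  rw [ht]
  by_cases h : P x e
  · simpa [h] using x.state_three (e i)
  · simpa [h] using x.state_three (e i + x.n)

theorem PredDef.dom (i j : Fin d) : PredDef fun x e => x.graph.Dom (e i) (e j) :=
  (PredDef.eq i j).or (.adj i j)

theorem PredDef.near2 (i j : Fin d) : PredDef fun x e => x.graph.Near2 (e i) (e j) :=
  .ex (.and (.dom _ _) (.dom _ _))

theorem PredDef.near4 (i j : Fin d) : PredDef fun x e => x.graph.Near4 (e i) (e j) :=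
  .ex (.and (.near2 _ _) (.near2 _ _))

theorem PredDef.code_ne_zero (i : Fin d) : PredDef fun x e => x.code (e i) ≠ 0 :=
  (FunDef.code i).ne_zero

variable (u v d' e' : Fin d)

theorem PredDef.hit (y : Fin d) :
    PredDef fun x e => x.graph.Hit (e v) (e d') (e e') (e y) :=
  .or (.dom _ _) (.or (.dom _ _) (.dom _ _))

theorem PredDef.avail (a : Fin d) :
    PredDef fun x e => x.graph.Avail (e u) (e v) (e d') (e e') (e a) :=
  .and (.near4 _ _) (.and (.not (.near2 _ _)) (.and (.not (.near2 _ _)) (.not (.near2 _ _))))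

theorem PredDef.mate (a b : Fin d) :
    PredDef fun x e => x.graph.Mate (e u) (e v) (e d') (e e') (e a) (e b) :=
  .ex (.and (.avail _ _ _ _ _) (.and (.dom _ _) (.dom _ _)))

theorem PredDef.covers (c y : Fin d) :
    PredDef fun x e => x.graph.Covers (e u) (e v) (e d') (e e') (e c) (e y) :=
  .all (.imp (.avail _ _ _ _ _) (.imp (.mate _ _ _ _ _ _) (.dom _ _)))

theorem PredDef.meets (c y : Fin d) :
    PredDef fun x e => x.graph.Meets (e u) (e v) (e d') (e e') (e c) (e y) :=
  .ex (.and (.avail _ _ _ _ _) (.and (.mate _ _ _ _ _ _) (.dom _ _)))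

theorem PredDef.covered (y : Fin d) :
    PredDef fun x e => x.graph.Covered (e u) (e v) (e d') (e e') (e y) :=
  .ex (.and (.avail _ _ _ _ _) (.covers _ _ _ _ _ _))

theorem PredDef.good (c : Fin d) :
    PredDef fun x e => x.graph.Good x.code (e u) (e v) (e d') (e e') (e c) :=
  .and (.avail _ _ _ _ _) (.and (.code_ne_zero _) (.all (.imp (.near4 _ _)
    (.imp (.not (.hit _ _ _ _)) (.imp (.meets _ _ _ _ _ _) (.and
      (.imp (.covered _ _ _ _ _) (.imp (.dom _ _) (.covers _ _ _ _ _ _)))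
      (.imp (.not (.covered _ _ _ _ _)) (.dom _ _))))))))

theorem PredDef.sel (c : Fin d) :
    PredDef fun x e => x.graph.Sel x.code (e u) (e v) (e d') (e e') (e c) :=
  .and (.good _ _ _ _ _) (.all (.imp (.good _ _ _ _ _) (.imp (.mate _ _ _ _ _ _)
    (.or (FunDef.lt (.code _) (.code _)) (.and (FunDef.eq (.code _) (.code _)) (.le _ _))))))

theorem PredDef.sol (c : Fin d) :
    PredDef fun x e => x.graph.Sol x.code (e u) (e v) (e d') (e e') (e c) :=
  .or (.eq _ _) (.or (.eq _ _) (.or (.eq _ _) (.sel _ _ _ _ _)))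

theorem PredDef.valid :
    PredDef fun x e => x.graph.Valid x.code (e u) (e v) (e d') (e e') :=
  .and (.and (.near4 _ _) (.and (.near4 _ _) (.near4 _ _)))
    (.and (.and (.code_ne_zero _) (.and (.code_ne_zero _) (.code_ne_zero _)))
      (.all (.imp (.near4 _ _) (.ex (.and (.sol _ _ _ _ _) (.and (.dom _ _)
        (.all (.imp (.sol _ _ _ _ _) (.imp (.dom _ _) (.eq _ _))))))))))

theorem FunDef.cost :
    FunDef fun x e => x.graph.cost x.code (e u) (e v) (e d') (e e') := by
  classical
  -- The subtraction of `1` may act on the whole conditional because `0 - 1 = 0`.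
  have h := FunDef.sum (d := d) (f := fun x e i =>
      (if x.graph.Sol x.code (e u) (e v) (e d') (e e') i then x.code i else 0) - 1)
    (.sub (.code_of _ (.sol _ _ _ _ _)) (.const 1))
  obtain ⟨t, ht⟩ := h
  refine ⟨t, fun x e => ?_⟩
  rw [ht]
  unfold SimpleGraph.cost
  refine Finset.sum_congr rfl fun i _ => ?_
  split_ifs <;> rfl

theorem PredDef.best :
    PredDef fun x e => x.graph.Best x.code (e u) (e v) (e d') (e e') :=
  .and (.valid _ _ _ _) (.all (.all (.all (.imp (.valid _ _ _ _)
    (.or (FunDef.lt (.cost _ _ _ _) (.cost _ _ _ _))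
      (.and (FunDef.eq (.cost _ _ _ _) (.cost _ _ _ _))
        (.or (.lt _ _) (.and (.eq _ _) (.or (.lt _ _) (.and (.eq _ _) (.le _ _)))))))))))

theorem PredDef.chosen : PredDef fun x e => x.graph.Chosen x.code (e u) :=
  .ex (.ex (.ex (.and (.best _ _ _ _) (.sol _ _ _ _ _))))

/-- Every vertex has a valid guess for its component. -/
def Instance.Solvable (x : Instance) : Prop := ∀ u, ∃ v d e, x.graph.Valid x.code u v d e

theorem PredDef.solvable : PredDef (d := d) fun x _ => x.Solvable :=
  .all (.ex (.ex (.ex (.valid _ _ _ _))))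

end

end WED

/-! ### Input length and correctness of the answer -/

namespace RAM

theorem size_getD_le_inputLength {x : List (List ℕ)} {l : List ℕ} (hl : l ∈ x) (i : ℕ) :
    Nat.size (l.getD i 0) ≤ inputLength x := by
  by_cases hi : i < l.length
  · rw [List.getD_eq_getElem _ _ hi]
    have h₁ : Nat.size l[i] + 1 ≤ (l.map fun a => Nat.size a + 1).sum :=
      List.single_le_sum (by simp) _ (List.mem_map_of_mem (List.getElem_mem hi))
    have h₂ : (l.map fun a => Nat.size a + 1).sum ≤ inputLength x :=
      List.single_le_sum (by simp) _ (List.mem_map_of_mem hl)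
    omega
  · rw [List.getD_eq_default _ _ (by omega)]
    simp

theorem length_le_inputLength {x : List (List ℕ)} {l : List ℕ} (hl : l ∈ x) :
    l.length ≤ inputLength x := by
  have h₁ : l.length ≤ (l.map fun a => Nat.size a + 1).sum := by
    simp
  exact h₁.trans (List.single_le_sum (by simp) _
    (List.mem_map_of_mem (f := fun l : List ℕ => (l.map fun a => Nat.size a + 1).sum) hl))

end RAM

namespace WED

open RAM

theorem Instance.bounded (x : Instance) : Bounded (inputLength (encode x)) x.state := by
  refine ⟨?_, fun m i => ?_⟩
  · rw [x.state_one]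
    -- The number `n` itself has few digits; that it is at most the input length comes from the list
    -- of `n` weights.
    simpa using length_le_inputLength (x := encode x)
      (l := List.ofFn fun v : Fin x.n => encodeWeight (x.weight v)) (by simp [encode])
  · have : x.state (m + 1) = memOf ((encode x).getD m []) := rfl
    rw [this, memOf]
    refine size_getD_le_inputLength ?_ i
    have hm : (m : ℕ) < (encode x).length := m.2
    rw [List.getD_eq_getElem _ _ hm]
    exact List.getElem_mem hm

theorem Instance.code_eq_zero_iff {x : Instance} {v : Fin x.n} :
    x.code v = 0 ↔ x.weight v = ⊤ := by
  unfold Instance.code encodeWeight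
  induction x.weight v using ENat.recTopCoe <;> simp

theorem Instance.weight_eq {x : Instance} {v : Fin x.n} (h : x.code v ≠ 0) :
    x.weight v = ((x.code v - 1 : ℕ) : ℕ∞) := by
  obtain ⟨k, hk⟩ := ENat.ne_top_iff_exists.1 (mt Instance.code_eq_zero_iff.2 h)
  simp [Instance.code, encodeWeight, ← hk]

theorem Instance.weightOf_eq {x : Instance} {D : Finset (Fin x.n)} (h : ∀ v ∈ D, x.code v ≠ 0) :
    x.weightOf D = ((∑ v ∈ D, (x.code v - 1) : ℕ) : ℕ∞) := by
  rw [Instance.weightOf, Nat.cast_sum]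
  exact Finset.sum_congr rfl fun v hv => x.weight_eq (h v hv)

theorem Instance.code_ne_zero_of_weightOf {x : Instance} {D : Finset (Fin x.n)}
    (h : x.weightOf D ≠ ⊤) : ∀ v ∈ D, x.code v ≠ 0 := by
  intro v hv h0
  refine h (WithTop.sum_eq_top.2 ⟨v, hv, Instance.code_eq_zero_iff.1 h0⟩)

open Classical in
/-- The answer of the algorithm. -/
noncomputable def Instance.answer (x : Instance) : Answer x :=
  if x.Solvable then some (Finset.univ.filter fun v => x.graph.Chosen x.code v) else none

theorem isCorrect_answer {x : Instance}
    (hP : SimpleGraph.IsInducedFree (SimpleGraph.pathGraph 6) x.graph) :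
    IsCorrect x x.answer := by
  classical
  unfold Instance.answer
  split_ifs with h
  · have hne : ∀ v ∈ Finset.univ.filter fun v => x.graph.Chosen x.code v, x.code v ≠ 0 :=
      fun v hv => (Finset.mem_filter.1 hv).2.ne_zero
    refine ⟨?_, ?_, fun D' hD' => ?_⟩
    · simpa using SimpleGraph.isEfficientDominatingSet_chosen hP h
    · rw [Instance.weightOf_eq hne]
      exact ENat.natCast_ne_top _
    · by_cases hD : x.weightOf D' = ⊤
      · simp [hD]
      · have hω := Instance.code_ne_zero_of_weightOf hD
        rw [Instance.weightOf_eq hne, Instance.weightOf_eq hω, Nat.cast_le]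
        have := SimpleGraph.sum_chosen_le hP h hD' hω
        simpa [Finset.sum_ite_mem, Finset.sum_filter] using this
  · intro D' hD'
    by_contra hD
    exact h (hD'.exists_valid hP (Instance.code_ne_zero_of_weightOf hD))

-- The program always writes `n + 1` cells. In the negative case they are all `0`, which as memory
-- content is the same as `[0]`.
open Classical in
theorem memOf_answer (x : Instance) :
    memOf (encodeAnswer x x.answer) = memOf ((if x.Solvable then 1 else 0) ::
      List.ofFn fun v : Fin x.n => if x.Solvable ∧ x.graph.Chosen x.code v then 1 else 0) := by
  unfold Instance.answer
  split_ifs with h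
  · simp [encodeAnswer, h]
  · funext i
    cases i with
    | zero => simp [encodeAnswer, memOf]
    | succ i =>
      by_cases hi : i < x.n <;> simp [encodeAnswer, memOf, h, hi]

end WED

theorem mainTheorem2 :
    RAM.SolvableInPolyTime WED.encode WED.encodeAnswer WED.IsCorrect
      {x : WED.Instance | SimpleGraph.IsInducedFree (SimpleGraph.pathGraph 6) x.graph} := by
  classical
  obtain ⟨a, ha⟩ := (WED.PredDef.solvable (d := 0)).indicator
  obtain ⟨b, hb⟩ := ((WED.PredDef.solvable (d := 1)).and (WED.PredDef.chosen 0)).indicator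
  obtain ⟨p, hp⟩ := RAM.exists_exec_outputProg a b
  refine ⟨RAM.outputProg a b, p, fun x hx => ?_⟩
  obtain ⟨t, s, hex, ht, hs⟩ := hp _ x.state x.bounded rfl
  refine ⟨t, s, x.answer, hex, ht, ?_, WED.isCorrect_answer hx⟩
  rw [hs, WED.memOf_answer]
  have h₁ := ha x Fin.elim0
  have h₂ := fun v : Fin x.n => hb x fun _ => v
  rw [Subsingleton.elim (fun j => ((Fin.elim0 j : Fin x.n) : ℕ)) Fin.elim0] at h₁
  rw [h₁]
  refine congrArg (fun l => RAM.memOf (_ :: l)) ?_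
  rw [List.ofFn_congr x.state_one]
  exact congrArg List.ofFn (funext fun v => (h₂ v).trans (by beta_reduce; congr))
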